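/- Let $\mathcal M$ be the set of Borel probability measures on $[0,1]^2$ both of whose marginals are the uniform distribution on $[0,1]$ (copulas), with the topology of weak convergence, and let $u$ be Lebesgue measure on $[0,1]^2$. For $\pi\in S_n$ ($n\ge 1$) let $\mu_\pi\in\mathcal M$ be the measure whose density with respect to $u$ equals $n$ on the squares $\left[\frac{i-1}{n},\frac{i}{n}\right)\times\left[\frac{\pi(i)-1}{n},\frac{\pi(i)}{n}\right)$, $1\le i\le n$, and $0$ elsewhere. Let $\mathbb P_n$ be the uniform probability measure on $S_n$, and let $D(\mu\|u)\in[0,\infty]$ be the Kullback--Leibler divergence, that is, $\int\log\frac{d\mu}{du}\,d\mu$ if $\mu\ll u$, and $\infty$ otherwise. Then: 1. $\mu\mapsto D(\mu\|u)$ is a good rate function on $\mathcal M$: it is lower semicontinuous, and $\{\mu\in\mathcal M: D(\mu\|u)\le a\}$ is compact for every real $a\ge 0$. 2. The sequence $\mu_\pi$, $\pi\sim\mathbb P_n$, satisfies the large deviation principle on $\mathcal M$ with speed $n$ and rate function $D(\cdot\|u)$: for every set $A\subset\mathcal M$, $$-\inf_{\mu\in A^\circ}D(\mu\|u)\le\liminf_{n\to\infty}\frac1n\log\mathbb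 P_n(\mu_\pi\in A)\le\limsup_{n\to\infty}\frac1n\log\mathbb P_n(\mu_\pi\in A)\le-\inf_{\mu\in\overline A}D(\mu\|u),$$ where $A^\circ$ and $\overline A$ are the interior and closure of $A$ in $\mathcal M$, $\log 0=-\infty$ and $\inf\emptyset=+\infty$. -/

import Mathlib

open MeasureTheory Filter Topology
open scoped ENNReal NNReal unitInterval

/-- The half-open interval `[i/n, (i+1)/n)` inside `[0,1]`, for `i = 0, …, n-1`. -/
def gridCell (n : ℕ) (i : Fin n) : Set I :=
  {x | (i : ℝ) / n ≤ (x : ℝ) ∧ (x : ℝ) < ((i : ℝ) + 1) / n}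

/-- The step function on the unit square equal to `n` on the (pairwise disjoint) grid squares
`(i, π i)` and `0` elsewhere. -/
noncomputable def permDensity {n : ℕ} (π : Equiv.Perm (Fin n)) (p : I × I) : ℝ≥0∞ :=
  ∑ i : Fin n, (gridCell n i ×ˢ gridCell n (π i)).indicator (fun _ => (n : ℝ≥0∞)) p

/-- The measure on the unit square with density `permDensity π` with respect to Lebesgue
measure. -/
noncomputable def permMeasure {n : ℕ} (π : Equiv.Perm (Fin n)) : Measure (I × I) :=
  (volume : Measure (I × I)).withDensity (permDensity π)

/-- Copulas: Borel probability measures on the unit square both of whose marginals are uniform on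
`[0,1]`. As a subtype of `ProbabilityMeasure (I × I)` it carries the topology of weak
convergence. -/
abbrev Copula : Type :=
  {μ : ProbabilityMeasure (I × I) //
    (μ : Measure (I × I)).map Prod.fst = (volume : Measure I) ∧
    (μ : Measure (I × I)).map Prod.snd = (volume : Measure I)}

lemma measurableSet_gridCell (n : ℕ) (i : Fin n) : MeasurableSet (gridCell n i) :=
  (measurableSet_le measurable_const measurable_subtype_coe).inter
    (measurableSet_lt measurable_subtype_coe measurable_const)

lemma volume_gridCell (n : ℕ) (i : Fin n) : volume (gridCell n i) = (n : ℝ≥0∞)⁻¹ := by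
  have hn : 0 < n := i.pos
  have hn' : (0 : ℝ) < n := by exact_mod_cast hn
  have hi : ((i : ℕ) : ℝ) + 1 ≤ n := by exact_mod_cast i.isLt
  have h0 : (0 : ℝ) ≤ ((i : ℕ) : ℝ) := by positivity
  have ha : ((i : ℕ) : ℝ) / n ∈ Set.Icc (0 : ℝ) 1 :=
    ⟨by positivity, by rw [div_le_one hn']; linarith⟩
  have hb : (((i : ℕ) : ℝ) + 1) / n ∈ Set.Icc (0 : ℝ) 1 :=
    ⟨by positivity, by rw [div_le_one hn']; linarith⟩
  have : gridCell n i = Set.Ico (⟨_, ha⟩ : I) (⟨_, hb⟩ : I) := by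
    ext x
    simp [gridCell, ← Subtype.coe_le_coe, ← Subtype.coe_lt_coe]
  rw [this, unitInterval.volume_Ico]
  rw [show ((((i : ℕ) : ℝ) + 1) / n - ((i : ℕ) : ℝ) / n) = ((n : ℝ))⁻¹ by ring,
    ENNReal.ofReal_inv_of_pos hn', ENNReal.ofReal_natCast]

lemma sum_volume_inter_gridCell {n : ℕ} (hn : 0 < n) {s : Set I} (hs : MeasurableSet s) :
    ∑ i : Fin n, volume (s ∩ gridCell n i) = volume s := by
  have hn' : (0 : ℝ) < n := by exact_mod_cast hn
  have hfl : ∀ (i : Fin n) (x : I), x ∈ gridCell n i → ⌊(n : ℝ) * x⌋₊ = (i : ℕ) := by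
    rintro i x ⟨h1, h2⟩
    rw [div_le_iff₀ hn'] at h1
    rw [lt_div_iff₀ hn'] at h2
    rw [Nat.floor_eq_iff (mul_nonneg hn'.le x.2.1)]
    constructor <;> linarith
  rw [← measure_biUnion_finset (fun i _ j _ hij => Set.disjoint_left.2 fun x hx hy =>
      hij (Fin.ext ((hfl i x hx.2).symm.trans (hfl j x hy.2))))
    (fun i _ => hs.inter (measurableSet_gridCell n i))]
  apply measure_congr
  have h1 : ∀ᵐ x : I, x ≠ 1 := by simp [ae_iff]
  filter_upwards [h1] with x hx
  apply propext
  change x ∈ (⋃ i ∈ (Finset.univ : Finset (Fin n)), s ∩ gridCell n i) ↔ x ∈ s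
  simp only [Finset.mem_univ, Set.iUnion_true, Set.mem_iUnion, Set.mem_inter_iff]
  refine ⟨fun ⟨_, h, _⟩ => h, fun h => ?_⟩
  have hx1 : (x : ℝ) < 1 := lt_of_le_of_ne x.2.2 fun e => hx (Subtype.ext e)
  have h0 : 0 ≤ (n : ℝ) * x := mul_nonneg hn'.le x.2.1
  refine ⟨⟨⌊(n : ℝ) * x⌋₊, (Nat.floor_lt h0).2 (by nlinarith)⟩, h, ?_, ?_⟩
  · rw [div_le_iff₀ hn']
    have := Nat.floor_le h0
    simp only
    linarith
  · rw [lt_div_iff₀ hn']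
    have := Nat.lt_floor_add_one ((n : ℝ) * x)
    simp only
    linarith

lemma permMeasure_prod {n : ℕ} (π : Equiv.Perm (Fin n)) {s t : Set I} (hs : MeasurableSet s)
    (ht : MeasurableSet t) :
    permMeasure π (s ×ˢ t) =
      ∑ i : Fin n, n * (volume (s ∩ gridCell n i) * volume (t ∩ gridCell n (π i))) := by
  have hm : ∀ i : Fin n, MeasurableSet (gridCell n i ×ˢ gridCell n (π i)) := fun i =>
    (measurableSet_gridCell n i).prod (measurableSet_gridCell n (π i))
  rw [permMeasure, withDensity_apply _ (hs.prod ht)]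
  simp only [permDensity]
  rw [lintegral_finsetSum _ fun i _ => measurable_const.indicator (hm i)]
  refine Finset.sum_congr rfl fun i _ => ?_
  rw [lintegral_indicator (hm i), setLIntegral_const, Measure.restrict_apply (hm i),
    Set.prod_inter_prod, Measure.volume_eq_prod, Measure.prod_prod, Set.inter_comm s,
    Set.inter_comm t]

lemma permMeasure_map_fst {n : ℕ} (hn : 0 < n) (π : Equiv.Perm (Fin n)) :
    (permMeasure π).map Prod.fst = (volume : Measure I) := by
  have hn' : (n : ℝ≥0∞) ≠ 0 := by exact_mod_cast hn.ne'
  ext s hs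
  rw [Measure.map_apply measurable_fst hs, ← Set.prod_univ,
    permMeasure_prod π hs MeasurableSet.univ, ← sum_volume_inter_gridCell hn hs]
  refine Finset.sum_congr rfl fun i _ => ?_
  rw [Set.univ_inter, volume_gridCell, mul_comm, mul_assoc,
    ENNReal.inv_mul_cancel hn' (ENNReal.natCast_ne_top n), mul_one]

lemma permMeasure_map_snd {n : ℕ} (hn : 0 < n) (π : Equiv.Perm (Fin n)) :
    (permMeasure π).map Prod.snd = (volume : Measure I) := by
  have hn' : (n : ℝ≥0∞) ≠ 0 := by exact_mod_cast hn.ne'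
  ext s hs
  rw [Measure.map_apply measurable_snd hs, ← Set.univ_prod,
    permMeasure_prod π MeasurableSet.univ hs, ← sum_volume_inter_gridCell hn hs,
    ← Equiv.sum_comp π fun j => volume (s ∩ gridCell n j)]
  refine Finset.sum_congr rfl fun i _ => ?_
  rw [Set.univ_inter, volume_gridCell, ← mul_assoc,
    ENNReal.mul_inv_cancel hn' (ENNReal.natCast_ne_top n), one_mul]

lemma isProbabilityMeasure_permMeasure {n : ℕ} (hn : 0 < n) (π : Equiv.Perm (Fin n)) :
    IsProbabilityMeasure (permMeasure π) := by
  constructor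
  have h := congrArg (fun m : Measure I => m Set.univ) (permMeasure_map_fst hn π)
  simpa [Measure.map_apply measurable_fst MeasurableSet.univ] using h

/-- The copula `μ_π` attached to a permutation `π` of `n ≥ 1` points. -/
noncomputable def permCopula (n : ℕ+) (π : Equiv.Perm (Fin n)) : Copula :=
  ⟨⟨permMeasure π, isProbabilityMeasure_permMeasure n.pos π⟩,
    permMeasure_map_fst n.pos π, permMeasure_map_snd n.pos π⟩

/-- The probability that `μ_π ∈ A` when `π` is a uniformly random permutation of `n` points. -/
noncomputable def copulaProb (n : ℕ+) (A : Set Copula) : ℝ≥0∞ :=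
  (PMF.uniformOfFintype (Equiv.Perm (Fin n))).toOuterMeasure {π | permCopula n π ∈ A}

/-- A good rate function: lower semicontinuous, `[0,∞]`-valued, with compact sublevel sets. -/
structure IsGoodRateFunction {X : Type*} [TopologicalSpace X] (J : X → ℝ≥0∞) : Prop where
  lowerSemicontinuous : LowerSemicontinuous J
  isCompact_sublevel : ∀ a : ℝ≥0, IsCompact {x | J x ≤ a}

/-- The Kullback-Leibler divergence `D(μ‖u)` of a copula from Lebesgue measure `u` on the unit
square. -/
noncomputable def copulaRate (μ : Copula) : ℝ≥0∞ :=
  InformationTheory.klDiv (μ.1 : Measure (I × I)) (volume : Measure (I × I))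

/-! A uniform random permutation is the rank pattern of `n` independent uniform points in the
square: permuting the second coordinates among the points preserves Lebesgue measure. If both
families of coordinates are equidistributed at scale `1/k`, the `i`-th smallest coordinate lies
within `2/k` of `i/n`, so `μ_π` and the empirical measure give nearly the same integral to a fixed
continuous function. The problem thus becomes one of Sanov type for independent points.
Equidistribution has probability tending to 1, both under Lebesgue measure and under any copula,
because the marginals are uniform; it costs only constant factors. The transfer is done by
`volume_le_permProb` and `permProb_mul_volume_le`.

The rate function is handled through `D(μ‖u) = sup_f (∫ f dμ - ∫ e^f du + 1)` over bounded
continuous `f`. This gives lower semicontinuity, and goodness follows because the space of copulas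
is compact. For the upper bound, each copula in the closure has an `f` whose superlevel set is a
neighbourhood with a Chernoff bound (`eventually_permProb_le`); finitely many of these cover. For
the lower bound, the points are sampled from a copula `μ` of finite entropy, and the law of large
numbers for the log-likelihood ratio controls the change of measure (`eventually_le_permProb`). -/

/-! ### Variational formula for the Kullback-Leibler divergence -/

open InformationTheory in
/-- Young's inequality behind the variational formula for the Kullback-Leibler divergence. -/
lemma mul_sub_exp_add_one_le_klFun {g : ℝ} (hg : 0 ≤ g) (t : ℝ) :
    g * t - Real.exp t + 1 ≤ klFun g := by
  rw [klFun_apply]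
  rcases hg.eq_or_lt with rfl | hg
  · simp [Real.exp_nonneg]
  · have h := Real.add_one_le_exp (t - Real.log g)
    rw [Real.exp_sub, Real.exp_log hg, le_div_iff₀ hg] at h
    nlinarith

lemma integrable_of_bounded {α : Type*} {_ : MeasurableSpace α} {μ : Measure α}
    [IsFiniteMeasure μ] {f : α → ℝ} (hf : Measurable f) {C : ℝ} (hC : ∀ x, |f x| ≤ C) :
    Integrable f μ :=
  Integrable.of_bound hf.aestronglyMeasurable C (ae_of_all _ hC)

lemma integrable_exp_of_bounded {α : Type*} {_ : MeasurableSpace α} {μ : Measure α}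
    [IsFiniteMeasure μ] {f : α → ℝ} (hf : Measurable f) {C : ℝ} (hC : ∀ x, |f x| ≤ C) :
    Integrable (fun x => Real.exp (f x)) μ :=
  integrable_of_bounded hf.exp (C := Real.exp C) fun x => by
    rw [abs_of_pos (Real.exp_pos _)]
    exact Real.exp_le_exp.2 (le_of_abs_le (hC x))

open InformationTheory in
-- Young's inequality integrated at `g = dμ/dν`, `t = f x`. Having `∫ e^f` instead of its logarithm
-- makes the bound pointwise; the supremum over `f` is the same, as constants can be added to `f`.
lemma ofReal_integral_sub_integral_exp_le_klDiv {α : Type*} {_ : MeasurableSpace α}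
    {μ ν : Measure α} [IsProbabilityMeasure μ] [IsProbabilityMeasure ν] {f : α → ℝ}
    (hf : Measurable f) {C : ℝ} (hC : ∀ x, |f x| ≤ C) :
    ENNReal.ofReal (∫ x, f x ∂μ - ∫ x, Real.exp (f x) ∂ν + 1) ≤ klDiv μ ν := by
  by_cases htop : klDiv μ ν = ∞
  · simp [htop]
  obtain ⟨hac, hint⟩ := klDiv_ne_top_iff.1 htop
  rw [ENNReal.ofReal_le_iff_le_toReal htop, toReal_klDiv_eq_integral_klFun hac,
    ← integral_rnDeriv_smul hac]
  have hg : Integrable (fun x => (μ.rnDeriv ν x).toReal • f x) ν :=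
    (integrable_rnDeriv_smul_iff hac).2 (integrable_of_bounded hf hC)
  have he := integrable_exp_of_bounded (μ := ν) hf hC
  have h1 : (1 : ℝ) = ∫ _, (1 : ℝ) ∂ν := by simp
  have hge : Integrable (fun x => (μ.rnDeriv ν x).toReal • f x - Real.exp (f x)) ν := hg.sub he
  rw [h1, ← integral_sub hg he, ← integral_add hge (integrable_const _)]
  refine integral_mono (hge.add (integrable_const _))
    ((integrable_klFun_rnDeriv_iff hac).2 hint) fun x => ?_
  exact mul_sub_exp_add_one_le_klFun ENNReal.toReal_nonneg (f x)

/-- Truncation of a real number to `[1/(m+1), m+1]`. -/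
noncomputable def clampPos (m : ℕ) (g : ℝ) : ℝ := max ((m : ℝ) + 1)⁻¹ (min g (m + 1))

lemma inv_le_clampPos (m : ℕ) (g : ℝ) : ((m : ℝ) + 1)⁻¹ ≤ clampPos m g := le_max_left _ _

lemma inv_natCast_add_one_le_one (m : ℕ) : ((m : ℝ) + 1)⁻¹ ≤ 1 :=
  inv_le_one_of_one_le₀ (by linarith [m.cast_nonneg (α := ℝ)])

lemma clampPos_le (m : ℕ) (g : ℝ) : clampPos m g ≤ m + 1 :=
  max_le ((inv_natCast_add_one_le_one m).trans (by linarith [m.cast_nonneg (α := ℝ)]))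
    (min_le_right _ _)

lemma clampPos_pos (m : ℕ) (g : ℝ) : 0 < clampPos m g :=
  lt_of_lt_of_le (by positivity) (inv_le_clampPos m g)

lemma measurable_clampPos (m : ℕ) : Measurable (clampPos m) := by
  unfold clampPos; fun_prop

lemma abs_log_clampPos_le (m : ℕ) (g : ℝ) : |Real.log (clampPos m g)| ≤ Real.log (m + 1) := by
  rw [abs_le]
  constructor
  · rw [← Real.log_inv]
    exact Real.log_le_log (by positivity) (inv_le_clampPos m g)
  · exact Real.log_le_log (clampPos_pos m g) (clampPos_le m g)

/-- With `c = clampPos m g` the expression is `klFun c + (g - c) log c`. Where the clamp acts, `g -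
c` and `log c` have the same sign. Nonnegativity is what allows Fatou's lemma for the truncations.
-/
lemma mul_log_clampPos_nonneg (m : ℕ) (g : ℝ) :
    0 ≤ g * Real.log (clampPos m g) - clampPos m g + 1 := by
  have h1 := InformationTheory.klFun_nonneg (clampPos_pos m g).le
  rw [InformationTheory.klFun_apply] at h1
  have h2 : 0 ≤ (g - clampPos m g) * Real.log (clampPos m g) := by
    rcases lt_trichotomy g (clampPos m g) with h | h | h
    · have : clampPos m g = ((m : ℝ) + 1)⁻¹ := by
        unfold clampPos at h ⊢
        rcases lt_max_iff.1 h with h | h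
        · exact max_eq_left ((min_le_left _ _).trans h.le)
        · exact absurd (min_le_left g _) (not_le.2 h)
      refine mul_nonneg_of_nonpos_of_nonpos (by linarith) (Real.log_nonpos (clampPos_pos m g).le ?_)
      exact this ▸ inv_natCast_add_one_le_one m
    · simp [← h]
    · refine mul_nonneg (by linarith) (Real.log_nonneg ?_)
      have h' := (max_lt_iff.1 h).2
      have : (m : ℝ) + 1 ≤ g := by
        by_contra hc
        rw [min_eq_left (not_le.1 hc).le] at h'
        exact lt_irrefl _ h'
      unfold clampPos
      rw [min_eq_right this]
      exact le_max_of_le_right (by linarith [m.cast_nonneg (α := ℝ)])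
  nlinarith

open InformationTheory in
lemma tendsto_mul_log_clampPos {g : ℝ} (hg : 0 ≤ g) :
    Tendsto (fun m : ℕ => g * Real.log (clampPos m g) - clampPos m g + 1) atTop
      (𝓝 (klFun g)) := by
  rcases hg.eq_or_lt with rfl | hg
  · have h : ∀ m : ℕ, clampPos m 0 = ((m : ℝ) + 1)⁻¹ := fun m =>
      max_eq_left ((min_le_left _ _).trans (by positivity))
    simp only [h, zero_mul, zero_sub, klFun_zero]
    have := (tendsto_one_div_add_atTop_nhds_zero_nat (𝕜 := ℝ)).neg.add_const 1
    simpa using this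
  · refine tendsto_const_nhds.congr' ?_
    obtain ⟨N, hN⟩ := exists_nat_gt (max g g⁻¹)
    filter_upwards [eventually_ge_atTop N] with m hm
    have hm' : (N : ℝ) ≤ m := by exact_mod_cast hm
    have h1 : g ≤ m + 1 := by linarith [(le_max_left g g⁻¹).trans_lt hN]
    have h2 : ((m : ℝ) + 1)⁻¹ ≤ g :=
      inv_le_of_inv_le₀ hg (by linarith [(le_max_right g g⁻¹).trans_lt hN])
    have : clampPos m g = g := by
      unfold clampPos
      rw [min_eq_left h1, max_eq_right h2]
    rw [this, klFun_apply]
    ring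

open InformationTheory in
/-- The Kullback-Leibler divergence is approached by the variational functional at bounded
measurable functions. -/
lemma exists_measurable_lt_integral_sub_integral_exp {α : Type*} {_ : MeasurableSpace α}
    {μ ν : Measure α} [IsProbabilityMeasure μ] [IsProbabilityMeasure ν] {a : ℝ}
    (ha : ENNReal.ofReal a < klDiv μ ν) :
    ∃ f : α → ℝ, ∃ C : ℝ, Measurable f ∧ (∀ x, |f x| ≤ C) ∧
      a < ∫ x, f x ∂μ - ∫ x, Real.exp (f x) ∂ν + 1 := by
  by_cases hac : μ ≪ ν
  · rw [klDiv_eq_lintegral_klFun_of_ac hac] at ha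
    have hlog : ∀ m, Measurable fun x => Real.log (clampPos m (μ.rnDeriv ν x).toReal) := fun m =>
      ((measurable_clampPos m).comp (Measure.measurable_rnDeriv μ ν).ennreal_toReal).log
    have hbd : ∀ (m : ℕ) x, |Real.log (clampPos m (μ.rnDeriv ν x).toReal)| ≤ Real.log (m + 1) :=
      fun m x => abs_log_clampPos_le m _
    have hm : ∀ m, Measurable fun x => ENNReal.ofReal ((μ.rnDeriv ν x).toReal *
        Real.log (clampPos m (μ.rnDeriv ν x).toReal) - clampPos m (μ.rnDeriv ν x).toReal + 1) :=
      fun m => ((((Measure.measurable_rnDeriv μ ν).ennreal_toReal.mul (hlog m)).sub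
        ((measurable_clampPos m).comp
          (Measure.measurable_rnDeriv μ ν).ennreal_toReal)).add_const 1).ennreal_ofReal
    -- Fatou: the functional at `f = log (clampPos m (dμ/dν))` has liminf at least the divergence,
    -- so some `m` already exceeds `a`.
    have hF := lintegral_liminf_le (μ := ν) (u := atTop) hm
    have hlim : ∀ x, liminf (fun m : ℕ => ENNReal.ofReal ((μ.rnDeriv ν x).toReal *
        Real.log (clampPos m (μ.rnDeriv ν x).toReal) - clampPos m (μ.rnDeriv ν x).toReal + 1))
          atTop = ENNReal.ofReal (klFun (μ.rnDeriv ν x).toReal) := fun x =>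
      (ENNReal.tendsto_ofReal (tendsto_mul_log_clampPos ENNReal.toReal_nonneg)).liminf_eq
    simp only [hlim] at hF
    obtain ⟨m, hm'⟩ := (eventually_lt_of_lt_liminf (ha.trans_le hF)).exists
    refine ⟨_, _, hlog m, hbd m, ?_⟩
    have hg : Integrable (fun x => (μ.rnDeriv ν x).toReal •
        Real.log (clampPos m (μ.rnDeriv ν x).toReal)) ν :=
      (integrable_rnDeriv_smul_iff hac).2 (integrable_of_bounded (hlog m) (hbd m))
    have he := integrable_exp_of_bounded (μ := ν) (hlog m) (hbd m)
    have h1 : (1 : ℝ) = ∫ _, (1 : ℝ) ∂ν := by simp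
    simp only [Real.exp_log (clampPos_pos m _)] at he
    have hge : Integrable (fun x => (μ.rnDeriv ν x).toReal •
        Real.log (clampPos m (μ.rnDeriv ν x).toReal) - clampPos m (μ.rnDeriv ν x).toReal) ν :=
      hg.sub he
    simp only [Real.exp_log (clampPos_pos m _)]
    rw [← integral_rnDeriv_smul hac, h1, ← integral_sub hg he,
      ← integral_add hge (integrable_const _)]
    have key := ofReal_integral_eq_lintegral_ofReal (hge.add (integrable_const (1 : ℝ)))
      (ae_of_all _ fun x => mul_log_clampPos_nonneg m _)
    replace hm' := hm'.trans_eq key.symm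
    exact (ENNReal.ofReal_lt_ofReal_iff'.1 hm').1
  -- Without absolute continuity, `M` times the indicator of a `ν`-null set `s` has functional value
  -- `M * μ s`, which is unbounded in `M`.
  · obtain ⟨s, hs, h0, h1⟩ : ∃ s, MeasurableSet s ∧ ν s = 0 ∧ μ s ≠ 0 := by
      by_contra hc
      push Not at hc
      exact hac (Measure.AbsolutelyContinuous.mk hc)
    have hpos : 0 < μ.real s := ENNReal.toReal_pos h1 (measure_ne_top _ _)
    obtain ⟨M, hM⟩ := exists_nat_gt (a / μ.real s)
    refine ⟨s.indicator fun _ => (M : ℝ), M, measurable_const.indicator hs, fun x => ?_, ?_⟩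
    · by_cases hx : x ∈ s <;> simp [hx]
    · have h2 : ∫ x, Real.exp (s.indicator (fun _ => (M : ℝ)) x) ∂ν = 1 := by
        have : (fun x => Real.exp (s.indicator (fun _ => (M : ℝ)) x)) =ᵐ[ν] fun _ => 1 := by
          filter_upwards [measure_eq_zero_iff_ae_notMem.1 h0] with x hx
          simp [hx]
        rw [integral_congr_ae this]
        simp
      rw [h2, integral_indicator_const _ hs, smul_eq_mul, sub_add_cancel]
      rwa [div_lt_iff₀ hpos, mul_comm] at hM

lemma abs_exp_sub_exp_le {C s t : ℝ} (hs : s ≤ C) (ht : t ≤ C) :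
    |Real.exp s - Real.exp t| ≤ Real.exp C * |s - t| := by
  wlog h : t ≤ s generalizing s t
  · rw [abs_sub_comm, abs_sub_comm s]
    exact this ht hs (not_le.1 h).le
  rw [abs_of_nonneg (sub_nonneg.2 (Real.exp_le_exp.2 h)), abs_of_nonneg (sub_nonneg.2 h)]
  have h1 := Real.add_one_le_exp (t - s)
  have h2 : Real.exp t = Real.exp s * Real.exp (t - s) := by rw [← Real.exp_add]; ring_nf
  have h3 : Real.exp s ≤ Real.exp C := Real.exp_le_exp.2 hs
  have h4 := Real.exp_pos s
  nlinarith

open InformationTheory in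
/-- The Kullback-Leibler divergence is approached by the variational functional at bounded
continuous functions. -/
lemma exists_boundedContinuous_lt_integral_sub_integral_exp {α : Type*} [MeasurableSpace α]
    [MetricSpace α] [BorelSpace α]
    {μ ν : Measure α} [IsProbabilityMeasure μ] [IsProbabilityMeasure ν] {a : ℝ}
    (ha : ENNReal.ofReal a < klDiv μ ν) :
    ∃ f : BoundedContinuousFunction α ℝ,
      a < ∫ x, f x ∂μ - ∫ x, Real.exp (f x) ∂ν + 1 := by
  obtain ⟨f, C, hf, hC, hlt⟩ := exists_measurable_lt_integral_sub_integral_exp ha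
  set L := ∫ x, f x ∂μ - ∫ x, Real.exp (f x) ∂ν + 1
  have hC0 : 0 ≤ C := by
    obtain ⟨x⟩ : Nonempty α := μ.nonempty_of_neZero
    exact (abs_nonneg _).trans (hC x)
  have hE := Real.exp_pos C
  set η : ℝ := (L - a) / (2 * (1 + Real.exp C)) with hη
  have hη0 : 0 < η := div_pos (by linarith) (by positivity)
  have hη1 : (1 + Real.exp C) * η < L - a := by
    have : (1 + Real.exp C) * η = (L - a) / 2 := by rw [hη]; field_simp
    linarith
  -- Approximating in `L¹(μ + ν)` controls both integrals at once. Truncating `g` to `[-C, C]`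
  -- brings it no farther from `f` and makes `exp` Lipschitz with constant `e^C` on the range; `η`
  -- makes the total error `(L - a) / 2`.
  obtain ⟨g, hg, hgi⟩ := (integrable_of_bounded (μ := μ + ν) hf
    hC).exists_boundedContinuous_integral_sub_le hη0
  let h : BoundedContinuousFunction α ℝ := BoundedContinuousFunction.ofNormedAddCommGroup
    (fun x => max (-C) (min (g x) C)) (by fun_prop) C fun x => by
      rw [Real.norm_eq_abs, abs_le]
      exact ⟨le_max_left _ _, max_le (by linarith) (min_le_right _ _)⟩
  have hhC : ∀ x, |h x| ≤ C := fun x => by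
    rw [abs_le]
    exact ⟨le_max_left _ _, max_le (by linarith) (min_le_right _ _)⟩
  have hhm : Measurable h := h.continuous.measurable
  have hfh : ∀ x, |f x - h x| ≤ |f x - g x| := fun x => by
    have hx := abs_le.1 (hC x)
    change |f x - max (-C) (min (g x) C)| ≤ _
    rcases le_total (g x) C with h1 | h1
    · rw [min_eq_left h1]
      rcases le_total (-C) (g x) with h2 | h2
      · rw [max_eq_right h2]
      · rw [max_eq_left h2, abs_of_nonneg (by linarith), abs_of_nonneg (by linarith)]
        linarith
    · rw [min_eq_right h1, max_eq_right (by linarith), abs_of_nonpos (by linarith),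
        abs_of_nonpos (by linarith)]
      linarith
  have hsub : ∀ ρ : Measure α, IsFiniteMeasure ρ → Integrable (fun x => |f x - h x|) ρ :=
    fun ρ _ => ((integrable_of_bounded hf hC).sub (integrable_of_bounded hhm hhC)).abs
  have htot : ∫ x, |f x - h x| ∂μ + ∫ x, |f x - h x| ∂ν ≤ η := by
    rw [← integral_add_measure (hsub μ inferInstance) (hsub ν inferInstance)]
    refine le_trans (integral_mono (hsub _ inferInstance) ?_ hfh) hg
    exact ((integrable_of_bounded hf hC).sub hgi).abs
  have hμ0 : 0 ≤ ∫ x, |f x - h x| ∂μ := integral_nonneg fun _ => abs_nonneg _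
  have hν0 : 0 ≤ ∫ x, |f x - h x| ∂ν := integral_nonneg fun _ => abs_nonneg _
  have h1 : |∫ x, f x ∂μ - ∫ x, h x ∂μ| ≤ ∫ x, |f x - h x| ∂μ := by
    rw [← integral_sub (integrable_of_bounded hf hC) (integrable_of_bounded hhm hhC)]
    exact abs_integral_le_integral_abs
  have h2 : |∫ x, Real.exp (f x) ∂ν - ∫ x, Real.exp (h x) ∂ν| ≤
      Real.exp C * ∫ x, |f x - h x| ∂ν := by
    have hef := integrable_exp_of_bounded (μ := ν) hf hC
    have heh := integrable_exp_of_bounded (μ := ν) hhm hhC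
    rw [← integral_sub hef heh, ← integral_const_mul]
    refine abs_integral_le_integral_abs.trans (integral_mono (hef.sub heh).abs
      ((hsub ν inferInstance).const_mul _) fun x => ?_)
    exact abs_exp_sub_exp_le (le_of_abs_le (hC x)) (le_of_abs_le (hhC x))
  refine ⟨h, ?_⟩
  have h3 := abs_le.1 h1
  have h4 := abs_le.1 h2
  have h5 : ∫ x, |f x - h x| ∂μ + Real.exp C * ∫ x, |f x - h x| ∂ν ≤ (1 + Real.exp C) * η := by
    nlinarith
  simp only [L] at hη1
  linarith [h3.2, h4.1]

/-! ### Sorted equidistributed points and integrals against `permMeasure` -/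

/-- The empirical distribution function of the points `x` is within `1/k` of the identity at the
points `j/k`. -/
def IsEquidistributed (k : ℕ) {n : ℕ} (x : Fin n → I) : Prop :=
  ∀ j ≤ k, |((Finset.univ.filter fun i => (x i : ℝ) ≤ (j : ℝ) / k).card : ℝ) / n - (j : ℝ) / k| ≤
    1 / k

lemma IsEquidistributed.comp_perm {k n : ℕ} {x : Fin n → I} (h : IsEquidistributed k x)
    (τ : Equiv.Perm (Fin n)) : IsEquidistributed k (x ∘ τ) := by
  intro j hj
  have : (Finset.univ.filter fun i => ((x ∘ τ) i : ℝ) ≤ (j : ℝ) / k).card =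
      (Finset.univ.filter fun i => (x i : ℝ) ≤ (j : ℝ) / k).card :=
    Finset.card_equiv τ (by simp)
  rw [this]
  exact h j hj

/-- Let `j = ⌈k x_i⌉`. By monotonicity at least `i + 1` points are at most `j/k`, and at most `i`
points are at most `(j-1)/k`. One `1/k` comes from equidistribution, the other from the spacing of
the grid. -/
lemma IsEquidistributed.abs_sub_le {k n : ℕ} (hk : 0 < k) {x : Fin n → I}
    (h : IsEquidistributed k x) (hx : Monotone x) (i : Fin n) :
    |(x i : ℝ) - (i : ℝ) / n| ≤ 2 / k := by
  have hn : (0 : ℝ) < n := by exact_mod_cast i.pos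
  have hk' : (0 : ℝ) < k := by exact_mod_cast hk
  have hx0 : 0 ≤ (k : ℝ) * x i := mul_nonneg hk'.le (x i).2.1
  set j := ⌈(k : ℝ) * x i⌉₊ with hj
  have hjk : j ≤ k := Nat.ceil_le.2 (by nlinarith [(x i).2.2])
  have h1 : (x i : ℝ) ≤ (j : ℝ) / k := by
    rw [le_div_iff₀ hk', mul_comm]
    exact Nat.le_ceil _
  have h2 : (j : ℝ) / k < x i + 1 / k := by
    have := Nat.ceil_lt_add_one hx0
    rw [div_lt_iff₀ hk', add_mul, one_div, inv_mul_cancel₀ hk'.ne', mul_comm]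
    exact this
  have e2 : (2 : ℝ) / k = 1 / k + 1 / k := by ring
  rw [abs_le]
  constructor
  · have hc : (i : ℕ) + 1 ≤ (Finset.univ.filter fun l => (x l : ℝ) ≤ (j : ℝ) / k).card := by
      rw [← Fin.card_Iic]
      refine Finset.card_le_card fun l hl => ?_
      simp only [Finset.mem_filter, Finset.mem_univ, true_and]
      exact le_trans (Subtype.coe_le_coe.2 (hx (Finset.mem_Iic.1 hl))) h1
    have hc' : ((i : ℕ) : ℝ) ≤ (Finset.univ.filter fun l => (x l : ℝ) ≤ (j : ℝ) / k).card := by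
      exact_mod_cast (Nat.le_succ _).trans hc
    have h3 := (abs_le.1 (h j hjk)).2
    have h4 := div_le_div_of_nonneg_right hc' hn.le
    linarith
  -- When `x i = 0` also `j = 0`, and there is no grid point `(j-1)/k` to use.
  · rcases hx0.eq_or_lt with h0 | h0
    · have : (x i : ℝ) = 0 := by
        rcases mul_eq_zero.1 h0.symm with h | h
        · exact absurd h hk'.ne'
        · exact h
      rw [this]
      have : 0 ≤ (i : ℝ) / n := by positivity
      have : (0 : ℝ) ≤ 2 / k := by positivity
      linarith
    · have hj1 : 1 ≤ j := Nat.ceil_pos.2 h0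
      have hcast : ((j - 1 : ℕ) : ℝ) = j - 1 := by push_cast [hj1]; ring
      have h5 : ((j - 1 : ℕ) : ℝ) / k < x i := by
        rw [hcast, sub_div]; linarith
      have hc : (Finset.univ.filter fun l => (x l : ℝ) ≤ ((j - 1 : ℕ) : ℝ) / k).card ≤ i := by
        rw [← Fin.card_Iio]
        refine Finset.card_le_card fun l hl => ?_
        simp only [Finset.mem_filter, Finset.mem_univ, true_and] at hl
        rw [Finset.mem_Iio]
        by_contra hc
        have : (x i : ℝ) ≤ x l := Subtype.coe_le_coe.2 (hx (not_lt.1 hc))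
        linarith
      have hc' : ((Finset.univ.filter fun l => (x l : ℝ) ≤ ((j - 1 : ℕ) : ℝ) / k).card : ℝ) ≤
          ((i : ℕ) : ℝ) := by exact_mod_cast hc
      have h3 := (abs_le.1 (h (j - 1) ((Nat.sub_le _ _).trans hjk))).1
      have h4 := div_le_div_of_nonneg_right hc' hn.le
      have h6 : ((j - 1 : ℕ) : ℝ) / k = (j : ℝ) / k - 1 / k := by rw [hcast, sub_div]
      linarith

lemma permMeasure_eq_sum {n : ℕ} (π : Equiv.Perm (Fin n)) :
    permMeasure π = ∑ i : Fin n, (n : ℝ≥0∞) •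
      (volume : Measure (I × I)).restrict (gridCell n i ×ˢ gridCell n (π i)) := by
  have hm : ∀ i : Fin n, MeasurableSet (gridCell n i ×ˢ gridCell n (π i)) := fun i =>
    (measurableSet_gridCell n i).prod (measurableSet_gridCell n (π i))
  ext s hs
  rw [permMeasure, withDensity_apply _ hs]
  simp only [permDensity]
  rw [lintegral_finsetSum _ fun i _ => measurable_const.indicator (hm i), Measure.finsetSum_apply]
  refine Finset.sum_congr rfl fun i _ => ?_
  rw [lintegral_indicator (hm i), setLIntegral_const, Measure.restrict_apply (hm i),
    Measure.smul_apply, smul_eq_mul, Measure.restrict_apply hs, Set.inter_comm]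

lemma abs_integral_permMeasure_sub_le {n : ℕ} (hn : 0 < n) (π : Equiv.Perm (Fin n))
    {f : I × I → ℝ} (hf : Continuous f) (z : Fin n → I × I) {ε : ℝ}
    (h : ∀ i, ∀ p ∈ gridCell n i ×ˢ gridCell n (π i), |f p - f (z i)| ≤ ε) :
    |∫ p, f p ∂permMeasure π - (∑ i, f (z i)) / n| ≤ ε := by
  have hn' : (0 : ℝ) < n := by exact_mod_cast hn
  have hint : Integrable f (volume : Measure (I × I)) :=
    hf.integrable_of_hasCompactSupport (HasCompactSupport.of_compactSpace f)
  have hvol : ∀ i, (volume : Measure (I × I)).real (gridCell n i ×ˢ gridCell n (π i)) =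
      (n : ℝ)⁻¹ * (n : ℝ)⁻¹ := fun i => by
    rw [Measure.real, Measure.volume_eq_prod, Measure.prod_prod, volume_gridCell, volume_gridCell]
    simp
  have key : ∀ i, |(n : ℝ) * (∫ p in gridCell n i ×ˢ gridCell n (π i), f p) - f (z i) / n| ≤
      ε / n := fun i => by
    have e : (n : ℝ) * (∫ p in gridCell n i ×ˢ gridCell n (π i), f p) - f (z i) / n =
        n * ∫ p in gridCell n i ×ˢ gridCell n (π i), (f p - f (z i)) := by
      rw [integral_sub hint.restrict (integrable_const _), setIntegral_const, hvol, smul_eq_mul]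
      field_simp
    have hb := norm_setIntegral_le_of_norm_le_const (μ := (volume : Measure (I × I)))
      (f := fun p => f p - f (z i)) (measure_lt_top _ _) (h i)
    rw [hvol, Real.norm_eq_abs] at hb
    rw [e, abs_mul, abs_of_pos hn']
    calc (n : ℝ) * |∫ p in gridCell n i ×ˢ gridCell n (π i), (f p - f (z i))|
        ≤ n * (ε * ((n : ℝ)⁻¹ * (n : ℝ)⁻¹)) := by gcongr
      _ = ε / n := by field_simp
  rw [permMeasure_eq_sum, integral_finsetSum_measure, Finset.sum_div, ← Finset.sum_sub_distrib]
  · refine (Finset.abs_sum_le_sum_abs _ _).trans ?_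
    have : ∑ _i : Fin n, ε / n = ε := by
      rw [Finset.sum_const, Finset.card_univ, Fintype.card_fin, nsmul_eq_mul]
      field_simp
    rw [← this]
    refine Finset.sum_le_sum fun i _ => ?_
    rw [integral_smul_measure, ENNReal.toReal_natCast, smul_eq_mul]
    exact key i
  · intro i _
    exact (hint.restrict).smul_measure (ENNReal.natCast_ne_top n)

/-- A point of cell `i` is within `1/n ≤ 1/k` of `i/n`, and the `i`-th sorted coordinate within
`2/k`; uniform continuity at distance `3/k` gives a `K` independent of the points and of `π`. -/
lemma exists_abs_integral_permMeasure_sub_le {f : I × I → ℝ} (hf : Continuous f) {ε : ℝ}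
    (hε : 0 < ε) :
    ∃ K : ℕ, ∀ k ≥ K, 0 < k → ∀ n ≥ k, ∀ (x y : Fin n → I), Monotone x → Monotone y →
      IsEquidistributed k x → IsEquidistributed k y → ∀ π : Equiv.Perm (Fin n),
        |∫ p, f p ∂permMeasure π - (∑ i, f (x i, y (π i))) / n| ≤ ε := by
  obtain ⟨δ, hδ, hfδ⟩ := Metric.uniformContinuous_iff.1
    (CompactSpace.uniformContinuous_of_continuous hf) ε hε
  obtain ⟨K, hK⟩ := exists_nat_gt (3 / δ)
  refine ⟨K, fun k hkK hk n hn x y hx hy hxk hyk π => ?_⟩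
  have hk' : (0 : ℝ) < k := by exact_mod_cast hk
  have hnk : (k : ℝ) ≤ n := by exact_mod_cast hn
  have hkδ : 3 / (k : ℝ) < δ := by
    have : (K : ℝ) ≤ k := by exact_mod_cast hkK
    rw [div_lt_iff₀ hδ] at hK
    rw [div_lt_iff₀ hk']
    nlinarith
  have hd : ∀ (w : Fin n → I), Monotone w → IsEquidistributed k w → ∀ i, ∀ p ∈ gridCell n i,
      dist p (w i) < δ := by
    intro w hw hwk i p hp
    have h1 := abs_le.1 (hwk.abs_sub_le hk hw i)
    have h2 : ((i : ℝ) + 1) / n ≤ (i : ℝ) / n + 1 / k := by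
      rw [add_div]
      gcongr
    have h3 : (3 : ℝ) / k = 2 / k + 1 / k := by ring
    have h4 : (0 : ℝ) < 1 / k := by positivity
    rw [Subtype.dist_eq, Real.dist_eq, abs_lt]
    have h5 := hp.1
    have h6 := hp.2
    constructor <;> linarith
  refine abs_integral_permMeasure_sub_le (hk.trans_le hn) π hf (fun i => (x i, y (π i)))
    fun i p hp => ?_
  rw [← Real.dist_eq]
  refine (hfδ ?_).le
  rw [Prod.dist_eq]
  exact max_lt (hd x hx hxk i _ hp.1) (hd y hy hyk (π i) _ hp.2)

/-! ### Transfer between random permutations and independent uniform points -/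

/-- The permutation of the second coordinates of a finite family of points by `ρ`. -/
def permuteSnd {n : ℕ} (ρ : Equiv.Perm (Fin n)) (z : Fin n → I × I) : Fin n → I × I :=
  fun i => ((z i).1, (z (ρ i)).2)

/-- The family of points whose sets of coordinates are those of `z`, the `i`-th smallest first
coordinate being matched with the `π i`-th smallest second coordinate. -/
noncomputable def matchSorted {n : ℕ} (π : Equiv.Perm (Fin n)) (z : Fin n → I × I) :
    Fin n → I × I :=
  fun i => ((z (Tuple.sort (fun j => (z j).1) i)).1, (z (Tuple.sort (fun j => (z j).2) (π i))).2)

/-- Lebesgue measure is a product, so the second coordinates form an exchangeable family independent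
of the first ones. -/
lemma measurePreserving_permuteSnd {n : ℕ} (ρ : Equiv.Perm (Fin n)) :
    MeasurePreserving (permuteSnd ρ) := by
  have h1 := volume_measurePreserving_arrowProdEquivProdArrow I I (Fin n)
  have h2 : MeasurePreserving (fun y : Fin n → I => y ∘ ρ) := by
    have e : (fun y : Fin n → I => y ∘ ρ) =
        MeasurableEquiv.piCongrLeft (fun _ : Fin n => I) ρ.symm := by
      funext y i
      have := Equiv.piCongrLeft_apply_apply (fun _ : Fin n => I) ρ.symm y (ρ i)
      rw [Equiv.symm_apply_apply] at this
      exact this.symm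
    rw [e]
    exact volume_measurePreserving_piCongrLeft (fun _ : Fin n => I) ρ.symm
  have h3 := (MeasurePreserving.id (volume : Measure (Fin n → I))).prod h2
  exact (h1.symm _).comp (h3.comp h1)

/-- Summing over all permutations, matching sorted coordinates and permuting second coordinates
give the same result for sets invariant under relabelling of the points. -/
lemma sum_indicator_matchSorted {n : ℕ} {B : Set (Fin n → I × I)}
    (hB : ∀ (τ : Equiv.Perm (Fin n)) z, z ∘ τ ∈ B ↔ z ∈ B) (z : Fin n → I × I) :
    ∑ π, B.indicator (fun _ => (1 : ℝ≥0∞)) (matchSorted π z) =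
      ∑ ρ, B.indicator (fun _ => (1 : ℝ≥0∞)) (permuteSnd ρ z) := by
  set s := Tuple.sort fun j => (z j).1
  set t := Tuple.sort fun j => (z j).2
  -- The bijection is `π ↦ t π s⁻¹`: the point of rank `i` has label `s i` and receives the second
  -- coordinate with label `t (π i)`.
  refine Fintype.sum_equiv ((Equiv.mulLeft t).trans (Equiv.mulRight s⁻¹)) _ _ fun π => ?_
  have : matchSorted π z =
      permuteSnd (((Equiv.mulLeft t).trans (Equiv.mulRight s⁻¹)) π) z ∘ s := by
    ext i
    · rfl
    · simp [matchSorted, permuteSnd, t]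
  rw [this]
  by_cases h : permuteSnd (((Equiv.mulLeft t).trans (Equiv.mulRight s⁻¹)) π) z ∈ B
  · rw [Set.indicator_of_mem h, Set.indicator_of_mem ((hB _ _).2 h)]
  · rw [Set.indicator_of_notMem h, Set.indicator_of_notMem (mt (hB _ _).1 h)]

/-- The probability of a set of permutations of `n` points under the uniform distribution. -/
noncomputable def permProb {n : ℕ} (U : Set (Equiv.Perm (Fin n))) : ℝ≥0∞ :=
  (PMF.uniformOfFintype (Equiv.Perm (Fin n))).toOuterMeasure U

lemma permProb_mul_factorial {n : ℕ} (U : Set (Equiv.Perm (Fin n))) :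
    permProb U * n.factorial = ∑ π, U.indicator (fun _ => (1 : ℝ≥0∞)) π := by
  classical
  rw [permProb, PMF.toOuterMeasure_uniformOfFintype_apply, Fintype.card_perm, Fintype.card_fin,
    ENNReal.div_mul_cancel (by exact_mod_cast n.factorial_ne_zero) (ENNReal.natCast_ne_top _)]
  simp [Set.indicator_apply, Finset.sum_boole, Fintype.card_subtype]

lemma lintegral_sum_indicator_permuteSnd {n : ℕ} {B : Set (Fin n → I × I)}
    (hBm : MeasurableSet B) :
    ∫⁻ z, ∑ ρ : Equiv.Perm (Fin n), B.indicator (fun _ => (1 : ℝ≥0∞)) (permuteSnd ρ z) =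
      volume B * n.factorial := by
  have hm : Measurable (B.indicator fun _ => (1 : ℝ≥0∞)) := measurable_const.indicator hBm
  have hm' : ∀ ρ : Equiv.Perm (Fin n), Measurable fun z =>
      B.indicator (fun _ => (1 : ℝ≥0∞)) (permuteSnd ρ z) := fun ρ =>
    hm.comp (measurePreserving_permuteSnd ρ).measurable
  rw [lintegral_finsetSum _ fun ρ _ => hm' ρ]
  simp_rw [(measurePreserving_permuteSnd _).lintegral_comp hm]
  rw [lintegral_indicator_const hBm, one_mul, Finset.sum_const, Finset.card_univ,
    Fintype.card_perm, Fintype.card_fin, nsmul_eq_mul, mul_comm]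

/-- The number of `π` with `matchSorted π z ∈ B` has mean `n! * volume B` over `z`, and for every
`z` it is at most the cardinality of `U`. -/
lemma volume_le_permProb {n : ℕ} {B : Set (Fin n → I × I)} (hBm : MeasurableSet B)
    (hB : ∀ (τ : Equiv.Perm (Fin n)) z, z ∘ τ ∈ B ↔ z ∈ B) {U : Set (Equiv.Perm (Fin n))}
    (h : ∀ z π, matchSorted π z ∈ B → π ∈ U) :
    volume B ≤ permProb U := by
  have h0 : (n.factorial : ℝ≥0∞) ≠ 0 := by exact_mod_cast n.factorial_ne_zero
  refine (ENNReal.mul_le_mul_iff_left h0 (ENNReal.natCast_ne_top _)).1 ?_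
  rw [permProb_mul_factorial, ← lintegral_sum_indicator_permuteSnd hBm]
  calc ∫⁻ z, ∑ ρ : Equiv.Perm (Fin n), B.indicator (fun _ => (1 : ℝ≥0∞)) (permuteSnd ρ z)
      ≤ ∫⁻ _ : Fin n → I × I, ∑ π, U.indicator (fun _ => (1 : ℝ≥0∞)) π := by
        refine lintegral_mono fun z => ?_
        rw [← sum_indicator_matchSorted hB]
        refine Finset.sum_le_sum fun π _ => ?_
        by_cases hz : matchSorted π z ∈ B
        · rw [Set.indicator_of_mem hz, Set.indicator_of_mem (h z π hz)]
        · simp [hz]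
    _ = _ := by simp

/-- The same count, now bounded below by the cardinality of `U` for `z` in the set `T` of typical
samples. -/
lemma permProb_mul_volume_le {n : ℕ} {B T : Set (Fin n → I × I)} (hBm : MeasurableSet B)
    (hTm : MeasurableSet T) (hB : ∀ (τ : Equiv.Perm (Fin n)) z, z ∘ τ ∈ B ↔ z ∈ B)
    {U : Set (Equiv.Perm (Fin n))} (h : ∀ z ∈ T, ∀ π ∈ U, matchSorted π z ∈ B) :
    permProb U * volume T ≤ volume B := by
  have h0 : (n.factorial : ℝ≥0∞) ≠ 0 := by exact_mod_cast n.factorial_ne_zero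
  refine (ENNReal.mul_le_mul_iff_left h0 (ENNReal.natCast_ne_top _)).1 ?_
  rw [mul_right_comm, permProb_mul_factorial, ← lintegral_sum_indicator_permuteSnd hBm,
    ← lintegral_indicator_const hTm]
  refine lintegral_mono fun z => ?_
  rw [← sum_indicator_matchSorted hB]
  by_cases hz : z ∈ T
  · rw [Set.indicator_of_mem hz]
    refine Finset.sum_le_sum fun π _ => ?_
    by_cases hπ : π ∈ U
    · rw [Set.indicator_of_mem hπ, Set.indicator_of_mem (h z hz π hπ)]
    · simp [hπ]
  · simp [hz]

/-! ### Product measures: change of measure, Chernoff bound, law of large numbers -/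

open ProbabilityTheory in
lemma lintegral_pi_prod {α : Type*} {_ : MeasurableSpace α} (ν : Measure α)
    [IsProbabilityMeasure ν] {n : ℕ} {g : Fin n → α → ℝ≥0∞} (hg : ∀ i, Measurable (g i)) :
    ∫⁻ z, ∏ i, g i (z i) ∂Measure.pi (fun _ : Fin n => ν) = ∏ i, ∫⁻ x, g i x ∂ν := by
  have hind : iIndepFun (fun i (z : Fin n → α) => g i (z i)) (Measure.pi fun _ : Fin n => ν) :=
    iIndepFun_pi fun i => (hg i).aemeasurable
  have h := lintegral_prod_eq_prod_lintegral_of_indepFun Finset.univ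
    (fun i (z : Fin n → α) => g i (z i)) hind fun i => (hg i).comp (measurable_pi_apply i)
  rw [h]
  refine Finset.prod_congr rfl fun i _ => ?_
  exact (measurePreserving_eval (fun _ : Fin n => ν) i).lintegral_comp (hg i)

lemma pi_eq_withDensity {α : Type*} {_ : MeasurableSpace α} {μ ν : Measure α}
    [IsProbabilityMeasure μ] [IsProbabilityMeasure ν] (hac : μ ≪ ν) (n : ℕ) :
    Measure.pi (fun _ : Fin n => μ) =
      (Measure.pi fun _ : Fin n => ν).withDensity fun z => ∏ i, μ.rnDeriv ν (z i) := by
  refine (Measure.pi_eq fun s hs => ?_)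
  have hpi : MeasurableSet (Set.univ.pi s) := MeasurableSet.univ_pi hs
  rw [withDensity_apply _ hpi, ← lintegral_indicator hpi]
  have e : ∀ z : Fin n → α, (Set.univ.pi s).indicator (fun z => ∏ i, μ.rnDeriv ν (z i)) z =
      ∏ i, (s i).indicator (μ.rnDeriv ν) (z i) := fun z => by
    by_cases hz : z ∈ Set.univ.pi s
    · rw [Set.indicator_of_mem hz]
      exact Finset.prod_congr rfl fun i _ => (Set.indicator_of_mem (hz i trivial) _).symm
    · rw [Set.indicator_of_notMem hz]
      simp only [Set.mem_univ_pi, not_forall] at hz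
      obtain ⟨i, hi⟩ := hz
      exact (Finset.prod_eq_zero (Finset.mem_univ i) (Set.indicator_of_notMem hi _)).symm
  simp_rw [e]
  rw [lintegral_pi_prod ν fun i => (Measure.measurable_rnDeriv μ ν).indicator (hs i)]
  refine Finset.prod_congr rfl fun i _ => ?_
  rw [lintegral_indicator (hs i), Measure.setLIntegral_rnDeriv hac]

/-- Change of measure: where the empirical mean of the log-likelihood ratio is at most `c`, the
product of `μ` is at most `exp (n c)` times the product of `ν`. -/
lemma pi_le_exp_mul_pi {α : Type*} {_ : MeasurableSpace α} {μ ν : Measure α}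
    [IsProbabilityMeasure μ] [IsProbabilityMeasure ν] (hac : μ ≪ ν) {n : ℕ} (hn : 0 < n)
    {E : Set (Fin n → α)} (hE : MeasurableSet E) {c : ℝ}
    (h : ∀ z ∈ E, (∑ i, llr μ ν (z i)) / n ≤ c) :
    Measure.pi (fun _ : Fin n => μ) E ≤
      ENNReal.ofReal (Real.exp (n * c)) * Measure.pi (fun _ : Fin n => ν) E := by
  have hn' : (0 : ℝ) < n := by exact_mod_cast hn
  rw [pi_eq_withDensity hac, withDensity_apply _ hE]
  have hfin : ∀ᵐ z ∂Measure.pi (fun _ : Fin n => ν), ∀ i, μ.rnDeriv ν (z i) < ∞ := by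
    rw [ae_all_iff]
    intro i
    exact (Measure.quasiMeasurePreserving_eval (fun _ : Fin n => ν) i).ae
      (Measure.rnDeriv_lt_top μ ν)
  calc ∫⁻ z in E, ∏ i, μ.rnDeriv ν (z i) ∂Measure.pi (fun _ : Fin n => ν)
      ≤ ∫⁻ _ in E, ENNReal.ofReal (Real.exp (n * c)) ∂Measure.pi (fun _ : Fin n => ν) := by
        refine lintegral_mono_ae ?_
        filter_upwards [ae_restrict_of_ae hfin, ae_restrict_mem hE] with z hz hzE
        -- At a zero of the density `llr` takes the default value `log 0 = 0`, so the hypothesis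
        -- says nothing there; but then the product of densities vanishes.
        by_cases h0 : ∃ i, μ.rnDeriv ν (z i) = 0
        · obtain ⟨i, hi⟩ := h0
          rw [Finset.prod_eq_zero (Finset.mem_univ i) hi]
          exact zero_le
        · push Not at h0
          have e : ∀ i, μ.rnDeriv ν (z i) = ENNReal.ofReal (Real.exp (llr μ ν (z i))) := fun i => by
            rw [llr_def, Real.exp_log (ENNReal.toReal_pos (h0 i) (hz i).ne),
              ENNReal.ofReal_toReal (hz i).ne]
          simp_rw [e]
          rw [← ENNReal.ofReal_prod_of_nonneg fun i _ => (Real.exp_pos _).le, ← Real.exp_sum]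
          refine ENNReal.ofReal_le_ofReal (Real.exp_le_exp.2 ?_)
          have := h z hzE
          rwa [div_le_iff₀ hn', mul_comm] at this
    _ = _ := by rw [setLIntegral_const]

/-- Markov's inequality for `∏ e^{f(z_i)}`, whose integral is `m^n`. Using `m ≤ e^{m-1}` in place of
`log m` matches the functional in the variational formula. -/
lemma pi_avg_ge_le_exp {α : Type*} {_ : MeasurableSpace α} {ν : Measure α}
    [IsProbabilityMeasure ν] {f : α → ℝ} (hf : Measurable f) {C : ℝ} (hC : ∀ x, |f x| ≤ C)
    {n : ℕ} (hn : 0 < n) (c : ℝ) :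
    Measure.pi (fun _ : Fin n => ν) {z | c ≤ (∑ i, f (z i)) / n} ≤
      ENNReal.ofReal (Real.exp (-(n * (c - ∫ x, Real.exp (f x) ∂ν + 1)))) := by
  have hn' : (0 : ℝ) < n := by exact_mod_cast hn
  set m := ∫ x, Real.exp (f x) ∂ν with hm
  have hG : Measurable fun x => ENNReal.ofReal (Real.exp (f x)) := hf.exp.ennreal_ofReal
  have h1 : ∫⁻ z, ∏ i, ENNReal.ofReal (Real.exp (f (z i))) ∂Measure.pi (fun _ : Fin n => ν) ≤
      ENNReal.ofReal (Real.exp (n * (m - 1))) := by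
    rw [lintegral_pi_prod ν (g := fun _ x => ENNReal.ofReal (Real.exp (f x))) fun _ => hG,
      Finset.prod_const, Finset.card_univ, Fintype.card_fin,
      ← ofReal_integral_eq_lintegral_ofReal (integrable_exp_of_bounded hf hC)
        (ae_of_all _ fun x => (Real.exp_pos _).le), Real.exp_nat_mul,
      ENNReal.ofReal_pow (Real.exp_pos _).le]
    refine pow_le_pow_left₀ zero_le (ENNReal.ofReal_le_ofReal ?_) n
    linarith [Real.add_one_le_exp (m - 1)]
  have hset : {z : Fin n → α | c ≤ (∑ i, f (z i)) / n} ⊆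
      {z | ENNReal.ofReal (Real.exp (n * c)) ≤ ∏ i, ENNReal.ofReal (Real.exp (f (z i)))} := by
    intro z hz
    simp only [Set.mem_ofPred_eq] at hz ⊢
    rw [← ENNReal.ofReal_prod_of_nonneg fun i _ => (Real.exp_pos _).le, ← Real.exp_sum]
    refine ENNReal.ofReal_le_ofReal (Real.exp_le_exp.2 ?_)
    rwa [le_div_iff₀ hn', mul_comm] at hz
  have h2 := meas_ge_le_lintegral_div (μ := Measure.pi fun _ : Fin n => ν)
    (f := fun z => ∏ i, ENNReal.ofReal (Real.exp (f (z i))))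
    (Finset.measurable_prod _ fun i _ => hG.comp (measurable_pi_apply i)).aemeasurable
    (ε := ENNReal.ofReal (Real.exp (n * c)))
    (ENNReal.ofReal_pos.2 (Real.exp_pos _)).ne' ENNReal.ofReal_ne_top
  refine (measure_mono hset).trans (h2.trans ?_)
  refine (ENNReal.div_le_div_right h1 _).trans ?_
  rw [← ENNReal.ofReal_div_of_pos (Real.exp_pos _), ← Real.exp_sub]
  refine ENNReal.ofReal_le_ofReal (Real.exp_le_exp.2 ?_)
  linarith

open ProbabilityTheory in
/-- The weak law of large numbers on finite product spaces. -/
lemma tendsto_pi_abs_avg_sub_ge {α : Type*} {_ : MeasurableSpace α} (μ : Measure α)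
    [IsProbabilityMeasure μ] {f : α → ℝ} (hf : Measurable f) (hi : Integrable f μ) {ε : ℝ}
    (hε : 0 < ε) :
    Tendsto (fun n : ℕ => Measure.pi (fun _ : Fin n => μ)
      {z | ε ≤ |(∑ i, f (z i)) / n - ∫ x, f x ∂μ|}) atTop (𝓝 0) := by
  -- All the finite products are marginals of one infinite product, where the strong law gives
  -- almost sure convergence, hence convergence in measure.
  set P := Measure.infinitePi fun _ : ℕ => μ
  have hmp : ∀ i, MeasurePreserving (fun ω : ℕ → α => ω i) P μ :=
    measurePreserving_eval_infinitePi fun _ : ℕ => μ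
  have hmap : ∀ n : ℕ, P.map (fun ω (i : Fin n) => ω i) = Measure.pi fun _ : Fin n => μ := by
    intro n
    have h1 : iIndepFun (fun i (ω : ℕ → α) => ω i) P :=
      iIndepFun_infinitePi (P := fun _ : ℕ => μ) (X := fun _ x => x) fun _ => measurable_id
    have h2 := (iIndepFun.precomp (g := fun i : Fin n => (i : ℕ)) Fin.val_injective
      h1).map_fun_eq_pi_map fun i => (measurable_pi_apply _).aemeasurable
    rw [h2]
    congr 1
    funext i
    exact (hmp i).map_eq
  have hslln := strong_law_ae_real (μ := P) (fun i ω => f (ω i))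
    ((hmp 0).integrable_comp_of_integrable hi)
    (fun i j hij => (iIndepFun_infinitePi (P := fun _ : ℕ => μ) (X := fun _ => f)
      fun _ => hf).indepFun hij)
    fun i => ⟨(hf.comp (measurable_pi_apply i)).aemeasurable,
      (hf.comp (measurable_pi_apply 0)).aemeasurable, by
        have : ∀ j, P.map (fun ω : ℕ → α => f (ω j)) = μ.map f := fun j => by
          rw [← (hmp j).map_eq, Measure.map_map hf (hmp j).measurable]
          rfl
        rw [this, this]⟩
  have hint : ∫ ω, f (ω 0) ∂P = ∫ x, f x ∂μ := by
    rw [← (hmp 0).map_eq, integral_map (hmp 0).measurable.aemeasurable hf.aestronglyMeasurable]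
  simp only [hint] at hslln
  have htim := tendstoInMeasure_of_tendsto_ae (fun n => by
    refine (Measurable.div_const ?_ _).aestronglyMeasurable
    exact Finset.measurable_sum _ fun i _ => hf.comp (measurable_pi_apply i)) hslln
  refine (htim (ENNReal.ofReal ε) (ENNReal.ofReal_pos.2 hε)).congr fun n => ?_
  have hmeas : MeasurableSet {z : Fin n → α | ε ≤ |(∑ i, f (z i)) / n - ∫ x, f x ∂μ|} := by
    refine measurableSet_le measurable_const (Measurable.abs (Measurable.sub_const
      (Measurable.div_const ?_ _) _))
    exact Finset.measurable_sum _ fun i _ => hf.comp (measurable_pi_apply i)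
  rw [← hmap, Measure.map_apply (by fun_prop) hmeas]
  congr 1
  ext ω
  simp only [Set.mem_ofPred_eq, Set.mem_preimage]
  rw [edist_dist, ENNReal.ofReal_le_ofReal_iff dist_nonneg, Real.dist_eq,
    Finset.sum_range (fun i => f (ω i))]

/-! ### Independent samples are typically equidistributed -/

/-- The families of points both of whose coordinates are equidistributed at scale `1/k`. -/
def equidistributedSet (k n : ℕ) : Set (Fin n → I × I) :=
  {z | IsEquidistributed k (fun i => (z i).1) ∧ IsEquidistributed k (fun i => (z i).2)}

/-- The indicator function of `[0, t]`. -/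
noncomputable def indicatorLe (t : ℝ) (x : I) : ℝ := if (x : ℝ) ≤ t then 1 else 0

lemma measurable_indicatorLe (t : ℝ) : Measurable (indicatorLe t) :=
  Measurable.ite (measurableSet_le measurable_subtype_coe measurable_const) measurable_const
    measurable_const

lemma abs_indicatorLe_le (t : ℝ) (x : I) : |indicatorLe t x| ≤ 1 := by
  unfold indicatorLe
  split_ifs <;> simp

lemma integral_indicatorLe {t : ℝ} (ht : t ∈ Set.Icc (0 : ℝ) 1) :
    ∫ x : I, indicatorLe t x = t := by
  have h : indicatorLe t = (Set.Iic (⟨t, ht⟩ : I)).indicator fun _ => 1 := by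
    ext x
    simp [indicatorLe, Set.indicator_apply, ← Subtype.coe_le_coe]
  rw [h, integral_indicator_const _ measurableSet_Iic, Measure.real, unitInterval.volume_Iic]
  simp [ht.1]

lemma sum_indicatorLe {n : ℕ} (t : ℝ) (x : Fin n → I) :
    ∑ i, indicatorLe t (x i) = ((Finset.univ.filter fun i => (x i : ℝ) ≤ t).card : ℝ) := by
  simp [indicatorLe]

lemma measurableSet_isEquidistributed {α : Type*} {_ : MeasurableSpace α} {pr : α → I}
    (hpr : Measurable pr) (k n : ℕ) :
    MeasurableSet {z : Fin n → α | IsEquidistributed k fun i => pr (z i)} := by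
  have h : {z : Fin n → α | IsEquidistributed k fun i => pr (z i)} =
      ⋂ j ∈ Set.Iic k, {z : Fin n → α |
        |(∑ i, indicatorLe ((j : ℝ) / k) (pr (z i))) / n - (j : ℝ) / k| ≤ 1 / k} := by
    ext z
    simp [IsEquidistributed, sum_indicatorLe]
  rw [h]
  refine MeasurableSet.biInter (Set.to_countable _) fun j _ => ?_
  refine measurableSet_le (Measurable.abs (Measurable.sub_const (Measurable.div_const
    (Finset.measurable_sum _ fun i _ => ?_) _) _)) measurable_const
  exact (measurable_indicatorLe _).comp (hpr.comp (measurable_pi_apply i))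

/-- A union bound over the `k + 1` thresholds `j/k` of the weak law for indicators of `[0, j/k]`.
The uniform marginal identifies the means. -/
lemma tendsto_pi_not_isEquidistributed {α : Type*} {_ : MeasurableSpace α} {μ : Measure α}
    [IsProbabilityMeasure μ] {pr : α → I} (hpr : Measurable pr) (hμ : μ.map pr = volume) {k : ℕ}
    (hk : 0 < k) :
    Tendsto (fun n : ℕ => Measure.pi (fun _ : Fin n => μ)
      {z | ¬ IsEquidistributed k fun i => pr (z i)}) atTop (𝓝 0) := by
  have hk' : (0 : ℝ) < k := by exact_mod_cast hk
  have hj : ∀ j ≤ k, ∫ a, indicatorLe ((j : ℝ) / k) (pr a) ∂μ = (j : ℝ) / k := fun j hj => by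
    rw [← integral_map hpr.aemeasurable (measurable_indicatorLe _).aestronglyMeasurable, hμ]
    refine integral_indicatorLe ⟨by positivity, ?_⟩
    rw [div_le_one hk']
    exact_mod_cast hj
  have hm : ∀ t, Measurable fun a => indicatorLe t (pr a) := fun t =>
    (measurable_indicatorLe t).comp hpr
  have hsum : Tendsto (fun n : ℕ => ∑ j ∈ Finset.range (k + 1),
      Measure.pi (fun _ : Fin n => μ) {z | 1 / (k : ℝ) ≤
        |(∑ i, indicatorLe ((j : ℝ) / k) (pr (z i))) / n -
          ∫ a, indicatorLe ((j : ℝ) / k) (pr a) ∂μ|}) atTop (𝓝 0) := by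
    have := tendsto_finsetSum (Finset.range (k + 1)) fun j _ =>
      tendsto_pi_abs_avg_sub_ge μ (hm ((j : ℝ) / k))
        (integrable_of_bounded (hm _) fun a => abs_indicatorLe_le _ _)
        (show (0 : ℝ) < 1 / k by positivity)
    simpa using this
  refine tendsto_of_tendsto_of_tendsto_of_le_of_le tendsto_const_nhds hsum (fun _ => zero_le)
    fun n => ?_
  refine (measure_mono ?_).trans (measure_biUnion_finset_le (Finset.range (k + 1)) _)
  intro z hz
  simp only [IsEquidistributed, Set.mem_ofPred_eq, not_forall, not_le] at hz
  obtain ⟨j, hjk, hz⟩ := hz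
  simp only [Set.mem_iUnion, Finset.mem_range, Set.mem_ofPred_eq]
  refine ⟨j, Nat.lt_succ_of_le hjk, ?_⟩
  rw [hj j hjk, sum_indicatorLe]
  exact hz.le

lemma measurableSet_equidistributedSet (k n : ℕ) : MeasurableSet (equidistributedSet k n) :=
  (measurableSet_isEquidistributed measurable_fst k n).inter
    (measurableSet_isEquidistributed measurable_snd k n)

lemma tendsto_pi_compl_equidistributedSet {μ : Measure (I × I)} [IsProbabilityMeasure μ]
    (h1 : μ.map Prod.fst = volume) (h2 : μ.map Prod.snd = volume) {k : ℕ} (hk : 0 < k) :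
    Tendsto (fun n : ℕ => Measure.pi (fun _ : Fin n => μ) (equidistributedSet k n)ᶜ) atTop
      (𝓝 0) := by
  have h := (tendsto_pi_not_isEquidistributed measurable_fst h1 hk).add
    (tendsto_pi_not_isEquidistributed measurable_snd h2 hk)
  rw [add_zero] at h
  refine tendsto_of_tendsto_of_tendsto_of_le_of_le tendsto_const_nhds h (fun _ => zero_le)
    fun n => ?_
  refine (measure_mono fun z hz => ?_).trans (measure_union_le _ _)
  exact not_and_or.1 hz

lemma comp_perm_mem_equidistributedSet {k n : ℕ} (τ : Equiv.Perm (Fin n)) (z : Fin n → I × I) :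
    z ∘ τ ∈ equidistributedSet k n ↔ z ∈ equidistributedSet k n := by
  have h : ∀ (τ : Equiv.Perm (Fin n)) z, z ∈ equidistributedSet k n →
      z ∘ τ ∈ equidistributedSet k n := fun τ z hz => ⟨hz.1.comp_perm τ, hz.2.comp_perm τ⟩
  refine ⟨fun hz => ?_, h τ z⟩
  have := h τ⁻¹ _ hz
  rwa [Function.comp_assoc, ← Equiv.Perm.coe_mul, mul_inv_cancel, Equiv.Perm.coe_one,
    Function.comp_id] at this

lemma sum_comp_perm {n : ℕ} (f : I × I → ℝ) (τ : Equiv.Perm (Fin n)) (z : Fin n → I × I) :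
    ∑ i, f ((z ∘ τ) i) = ∑ i, f (z i) :=
  Equiv.sum_comp τ fun i => f (z i)

lemma matchSorted_mem_equidistributedSet {k n : ℕ} (π : Equiv.Perm (Fin n)) (z : Fin n → I × I) :
    matchSorted π z ∈ equidistributedSet k n ↔ z ∈ equidistributedSet k n := by
  have hx : (fun i => (matchSorted π z i).1) = (fun i => (z i).1) ∘ Tuple.sort fun j => (z j).1 :=
    rfl
  have hy : (fun i => (matchSorted π z i).2) =
    (fun i => (z i).2) ∘ ((Tuple.sort fun j => (z j).2) * π) := rfl
  have hiff : ∀ (τ : Equiv.Perm (Fin n)) (x : Fin n → I),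
      IsEquidistributed k (x ∘ τ) ↔ IsEquidistributed k x := fun τ x => by
    refine ⟨fun h => ?_, fun h => h.comp_perm τ⟩
    have := h.comp_perm τ⁻¹
    rwa [Function.comp_assoc, ← Equiv.Perm.coe_mul, mul_inv_cancel, Equiv.Perm.coe_one,
      Function.comp_id] at this
  simp only [equidistributedSet, Set.mem_ofPred_eq]
  rw [hx, hy, hiff, hiff]

lemma exists_abs_integral_sub_avg_matchSorted_le {f : I × I → ℝ} (hf : Continuous f) {ε : ℝ}
    (hε : 0 < ε) :
    ∃ K : ℕ, ∀ k ≥ K, 0 < k → ∀ n ≥ k, ∀ z ∈ equidistributedSet k n,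
      ∀ π : Equiv.Perm (Fin n),
        |∫ p, f p ∂permMeasure π - (∑ i, f (matchSorted π z i)) / n| ≤ ε := by
  obtain ⟨K, hK⟩ := exists_abs_integral_permMeasure_sub_le hf hε
  refine ⟨K, fun k hkK hk n hn z hz π => ?_⟩
  exact hK k hkK hk n hn _ _ (Tuple.monotone_sort fun j => (z j).1)
    (Tuple.monotone_sort fun j => (z j).2) (hz.1.comp_perm _) (hz.2.comp_perm _) π

lemma measurable_avg {α : Type*} {_ : MeasurableSpace α} {n : ℕ} {f : α → ℝ} (hf : Measurable f) :
    Measurable fun z : Fin n → α => (∑ i, f (z i)) / n :=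
  Measurable.div_const (Finset.measurable_sum _ fun i _ => hf.comp (measurable_pi_apply i)) _

lemma eventually_half_le_of_tendsto_compl {α : ℕ → Type*} {_ : ∀ n, MeasurableSpace (α n)}
    (P : ∀ n, Measure (α n)) [∀ n, IsProbabilityMeasure (P n)] {E : ∀ n, Set (α n)}
    (hE : ∀ n, MeasurableSet (E n)) (h : Tendsto (fun n => P n (E n)ᶜ) atTop (𝓝 0)) :
    ∀ᶠ n in atTop, 2⁻¹ ≤ P n (E n) := by
  filter_upwards [h.eventually (gt_mem_nhds (show (0 : ℝ≥0∞) < 2⁻¹ by simp))] with n hn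
  have h1 := prob_add_prob_compl (μ := P n) (hE n)
  by_contra hc
  have := ENNReal.add_lt_add (not_le.1 hc) hn
  rw [h1, ENNReal.inv_two_add_inv_two] at this
  exact lt_irrefl _ this

/-! ### Exponential bounds for random permutations -/

/-- Exponential upper bound for the probability that `μ_π` integrates `f` to more than `t`. -/
lemma eventually_permProb_le (f : BoundedContinuousFunction (I × I) ℝ) {ε : ℝ} (hε : 0 < ε)
    (t : ℝ) :
    ∀ᶠ n : ℕ in atTop,
      permProb {π : Equiv.Perm (Fin n) | t < ∫ p, f p ∂permMeasure π} ≤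
        2 * ENNReal.ofReal (Real.exp (-(n * (t - ε - (∫ p, Real.exp (f p)) + 1)))) := by
  obtain ⟨K, hK⟩ := exists_abs_integral_sub_avg_matchSorted_le f.continuous hε
  set k := K + 1
  have hT := eventually_half_le_of_tendsto_compl
    (fun n => Measure.pi fun _ : Fin n => (volume : Measure (I × I)))
    (measurableSet_equidistributedSet k)
    (tendsto_pi_compl_equidistributedSet measurePreserving_fst.map_eq
      measurePreserving_snd.map_eq K.succ_pos)
  filter_upwards [hT, eventually_ge_atTop k] with n hn hkn
  have hn0 : 0 < n := K.succ_pos.trans_le hkn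
  have hB : MeasurableSet {z : Fin n → I × I | t - ε ≤ (∑ i, f (z i)) / n} :=
    measurableSet_le measurable_const (measurable_avg f.continuous.measurable)
  have h1 := permProb_mul_volume_le hB (measurableSet_equidistributedSet k n)
    (fun τ z => by
      simp only [Set.mem_ofPred_eq]
      rw [sum_comp_perm])
    (U := {π : Equiv.Perm (Fin n) | t < ∫ p, f p ∂permMeasure π}) (fun z hz π hπ => by
      have := abs_le.1 (hK k (Nat.le_succ K) K.succ_pos n hkn z hz π)
      simp only [Set.mem_ofPred_eq] at hπ ⊢
      linarith [this.2])
  have h2 := pi_avg_ge_le_exp (ν := (volume : Measure (I × I))) f.continuous.measurable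
    (fun x => f.norm_coe_le_norm x) hn0 (t - ε)
  -- The factor 2 pays for restricting to equidistributed samples, of probability at least `1/2`.
  calc _ = 2 * (permProb {π : Equiv.Perm (Fin n) | t < ∫ p, f p ∂permMeasure π} * 2⁻¹) := by
        rw [mul_comm, mul_assoc, ENNReal.inv_mul_cancel (by simp) (by simp), mul_one]
    _ ≤ _ := by
        gcongr
        exact (mul_le_mul_right hn _).trans (h1.trans h2)

/-- Exponential lower bound for the probability that `μ_π` is close to a copula of finite
entropy. -/
lemma eventually_le_permProb (μ : Copula) (hμ : copulaRate μ ≠ ∞)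
    (J : Finset (BoundedContinuousFunction (I × I) ℝ))
    (ε : BoundedContinuousFunction (I × I) ℝ → ℝ) (hε : ∀ f ∈ J, 0 < ε f) {η : ℝ} (hη : 0 < η) :
    ∀ᶠ n : ℕ in atTop,
      2⁻¹ * ENNReal.ofReal (Real.exp (-(n * ((copulaRate μ).toReal + η)))) ≤
        permProb {π : Equiv.Perm (Fin n) |
          ∀ f ∈ J, |∫ p, f p ∂permMeasure π - ∫ p, f p ∂(μ.1 : Measure (I × I))| < ε f} := by
  set M : Measure (I × I) := (μ.1 : Measure (I × I)) with hM
  obtain ⟨hac, hint⟩ := InformationTheory.klDiv_ne_top_iff.1 hμ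
  have hD : (copulaRate μ).toReal = ∫ p, llr M volume p ∂M :=
    InformationTheory.toReal_klDiv_of_measure_eq hac (by simp)
  -- The condition `f ∈ J` sits inside the existential so that `K` becomes a total function, to
  -- which `J.sup` applies.
  have hK : ∀ f : BoundedContinuousFunction (I × I) ℝ, ∃ K : ℕ, f ∈ J → ∀ k ≥ K, 0 < k → ∀ n ≥ k,
      ∀ z ∈ equidistributedSet k n, ∀ π : Equiv.Perm (Fin n),
        |∫ p, f p ∂permMeasure π - (∑ i, f (matchSorted π z i)) / n| ≤ ε f / 2 := fun f => by
    by_cases hf : f ∈ J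
    · obtain ⟨K, hK⟩ := exists_abs_integral_sub_avg_matchSorted_le f.continuous
        (half_pos (hε f hf))
      exact ⟨K, fun _ => hK⟩
    · exact ⟨0, fun h => absurd h hf⟩
  choose K hK using hK
  set k := J.sup K + 1
  have hk : 0 < k := Nat.succ_pos _
  -- Half of `ε f` is for the fluctuation of the sample average, half for replacing it by the
  -- integral against `permMeasure π`. `E` adds typicality of the log-likelihood ratio, needed only
  -- for the change of measure and then dropped.
  let B : ∀ n : ℕ, Set (Fin n → I × I) := fun n => equidistributedSet k n ∩
    ⋂ f ∈ J, {z | |(∑ i, f (z i)) / n - ∫ p, f p ∂M| < ε f / 2}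
  let E : ∀ n : ℕ, Set (Fin n → I × I) := fun n => B n ∩
    {z | |(∑ i, llr M volume (z i)) / n - ∫ p, llr M volume p ∂M| < η}
  have hBm : ∀ n, MeasurableSet (B n) := fun n =>
    (measurableSet_equidistributedSet k n).inter <| Finset.measurableSet_biInter _ fun f _ =>
      measurableSet_lt ((measurable_avg f.continuous.measurable).sub_const _).abs measurable_const
  have hEm : ∀ n, MeasurableSet (E n) := fun n => (hBm n).inter <|
    measurableSet_lt ((measurable_avg (measurable_llr _ _)).sub_const _).abs measurable_const
  have hlim : Tendsto (fun n => Measure.pi (fun _ : Fin n => M) (E n)ᶜ) atTop (𝓝 0) := by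
    have h1 := tendsto_pi_compl_equidistributedSet μ.2.1 μ.2.2 hk
    have h2 := tendsto_finsetSum J fun f hf =>
      tendsto_pi_abs_avg_sub_ge M f.continuous.measurable (f.integrable M) (half_pos (hε f hf))
    have h3 := tendsto_pi_abs_avg_sub_ge M (measurable_llr M volume) hint hη
    have h4 := (h1.add h2).add h3
    simp only [Finset.sum_const_zero, add_zero] at h4
    refine tendsto_of_tendsto_of_tendsto_of_le_of_le tendsto_const_nhds h4 (fun _ => zero_le)
      fun n => ?_
    simp only [E, B]
    rw [Set.compl_inter, Set.compl_inter, Set.compl_iInter₂]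
    refine (measure_union_le _ _).trans (add_le_add ((measure_union_le _ _).trans
      (add_le_add le_rfl ((measure_biUnion_finset_le J _).trans
        (Finset.sum_le_sum fun f _ => measure_mono ?_)))) (measure_mono ?_))
    · intro z hz
      simpa using hz
    · intro z hz
      simpa using hz
  have hhalf := eventually_half_le_of_tendsto_compl
    (fun n => Measure.pi fun _ : Fin n => M) hEm hlim
  filter_upwards [hhalf, eventually_ge_atTop k] with n hn hkn
  have hn0 : 0 < n := hk.trans_le hkn
  have h1 := pi_le_exp_mul_pi hac hn0 (hEm n) (c := (copulaRate μ).toReal + η) fun z hz => by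
    have hz2 : |(∑ i, llr M volume (z i)) / n - ∫ p, llr M volume p ∂M| < η := hz.2
    have := (abs_lt.1 hz2).2
    rw [hD]
    linarith
  have h2 : Measure.pi (fun _ : Fin n => (volume : Measure (I × I))) (E n) ≤
      permProb {π : Equiv.Perm (Fin n) |
          ∀ f ∈ J, |∫ p, f p ∂permMeasure π - ∫ p, f p ∂M| < ε f} := by
    refine (measure_mono Set.inter_subset_left).trans (volume_le_permProb (hBm n) ?_ ?_)
    · intro τ z
      simp only [B, Set.mem_inter_iff, comp_perm_mem_equidistributedSet, Set.mem_iInter,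
        Set.mem_ofPred_eq]
      simp_rw [sum_comp_perm]
    · intro z π hz f hf
      have hz1 := (matchSorted_mem_equidistributedSet π z).1 hz.1
      have hz2 : |(∑ i, f (matchSorted π z i)) / n - ∫ p, f p ∂M| < ε f / 2 :=
        Set.mem_iInter₂.1 hz.2 f hf
      have hz3 := hK f hf k ((Finset.le_sup hf).trans (Nat.le_succ _)) hk n hkn z hz1 π
      calc _ ≤ _ := abs_sub_le _ ((∑ i, f (matchSorted π z i)) / n) _
        _ < ε f := by linarith
  refine le_trans ?_ h2
  have h3 := hn.trans h1
  rw [Real.exp_neg, ENNReal.ofReal_inv_of_pos (Real.exp_pos _)]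
  rw [← div_eq_mul_inv]
  exact ENNReal.div_le_of_le_mul' h3

/-! ### Topology of the space of copulas and goodness of the rate function -/

/-- Weak convergence is convergence of all integrals of bounded continuous functions, so finitely
many such constraints already force membership in a neighbourhood. -/
lemma exists_finset_abs_integral_sub_lt_subset {U : Set Copula} {μ : Copula} (hU : U ∈ 𝓝 μ) :
    ∃ (J : Finset (BoundedContinuousFunction (I × I) ℝ))
      (ε : BoundedContinuousFunction (I × I) ℝ → ℝ), (∀ f ∈ J, 0 < ε f) ∧
      ∀ ν : Copula, (∀ f ∈ J, |∫ p, f p ∂(ν.1 : Measure (I × I)) -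
        ∫ p, f p ∂(μ.1 : Measure (I × I))| < ε f) → ν ∈ U := by
  let Φ : BoundedContinuousFunction (I × I) ℝ → Copula → ℝ := fun f ν =>
    ∫ p, f p ∂(ν.1 : Measure (I × I))
  have hle : (⨅ f, comap (Φ f) (𝓝 (Φ f μ))) ≤ 𝓝 μ := by
    rw [← tendsto_id', tendsto_subtype_rng,
      ProbabilityMeasure.tendsto_iff_forall_integral_tendsto]
    intro f
    exact tendsto_comap.mono_left (iInf_le (fun f => comap (Φ f) (𝓝 (Φ f μ))) f)
  have hb := HasBasis.iInf' fun f => (Metric.nhds_basis_ball (x := Φ f μ)).comap (Φ f)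
  obtain ⟨⟨S, ε⟩, ⟨hS, hε⟩, hsub⟩ := hb.mem_iff.1 (hle hU)
  refine ⟨hS.toFinset, ε, fun f hf => hε f (hS.mem_toFinset.1 hf), fun ν hν => hsub ?_⟩
  rw [Set.mem_iInter₂]
  intro f hf
  exact hν f (hS.mem_toFinset.2 hf)

lemma continuous_integral_copula (f : BoundedContinuousFunction (I × I) ℝ) :
    Continuous fun μ : Copula => ∫ p, f p ∂(μ.1 : Measure (I × I)) :=
  (ProbabilityMeasure.continuous_integral_boundedContinuousFunction f).comp continuous_subtype_val

/-- Pushforward under a coordinate is weakly continuous, so the marginal constraints cut out a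
closed subset of the compact space of probability measures on the square. -/
instance : CompactSpace Copula := by
  have h : ∀ pr : C(I × I, I), IsClosed {μ : ProbabilityMeasure (I × I) |
      (μ : Measure (I × I)).map pr = (volume : Measure I)} := fun pr => by
    let v : ProbabilityMeasure I := ⟨volume, inferInstance⟩
    have e : {μ : ProbabilityMeasure (I × I) |
        (μ : Measure (I × I)).map pr = (volume : Measure I)} =
        (fun μ : ProbabilityMeasure (I × I) =>
          μ.map pr.continuous.measurable.aemeasurable) ⁻¹' {v} := by
      ext μ
      simp only [Set.mem_ofPred_eq, Set.mem_preimage, Set.mem_singleton_iff]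
      rw [← ProbabilityMeasure.toMeasure_injective.eq_iff]
      rfl
    rw [e]
    exact isClosed_singleton.preimage (ProbabilityMeasure.continuous_map pr.continuous)
  exact isCompact_iff_compactSpace.1 ((h ⟨Prod.fst, continuous_fst⟩).inter
    (h ⟨Prod.snd, continuous_snd⟩)).isCompact

lemma exists_boundedContinuous_lt_of_lt_copulaRate {μ : Copula} {a : ℝ}
    (ha : ENNReal.ofReal a < copulaRate μ) :
    ∃ f : BoundedContinuousFunction (I × I) ℝ,
      a + (∫ p, Real.exp (f p)) - 1 < ∫ p, f p ∂(μ.1 : Measure (I × I)) := by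
  obtain ⟨f, hf⟩ := exists_boundedContinuous_lt_integral_sub_integral_exp ha
  exact ⟨f, by linarith⟩

lemma lowerSemicontinuous_copulaRate : LowerSemicontinuous copulaRate := by
  intro μ b hb
  -- An intermediate level `r` is finite even if the rate at `μ` is not. The `f` that certifies it
  -- at `μ` certifies it on a neighbourhood.
  obtain ⟨r, hbr, hr⟩ := exists_between hb
  have hr0 : ENNReal.ofReal r.toReal = r := ENNReal.ofReal_toReal hr.ne_top
  obtain ⟨f, hf⟩ := exists_boundedContinuous_lt_of_lt_copulaRate (hr0.symm ▸ hr)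
  filter_upwards [(continuous_integral_copula f).continuousAt.eventually (lt_mem_nhds hf)] with ν hν
  refine hbr.trans_le ?_
  rw [← hr0]
  refine le_trans (ENNReal.ofReal_le_ofReal ?_) (ofReal_integral_sub_integral_exp_le_klDiv
    (μ := (ν.1 : Measure (I × I))) (ν := volume) f.continuous.measurable
    fun x => f.norm_coe_le_norm x)
  linarith

lemma isGoodRateFunction_copulaRate : IsGoodRateFunction copulaRate where
  lowerSemicontinuous := lowerSemicontinuous_copulaRate
  isCompact_sublevel a :=
    (lowerSemicontinuous_copulaRate.isClosed_preimage (a : ℝ≥0∞)).isCompact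

/-! ### The large deviation bounds -/

lemma PNat.tendsto_coe_atTop : Tendsto (fun n : ℕ+ => (n : ℕ)) atTop atTop :=
  tendsto_atTop.2 fun N => (eventually_ge_atTop (⟨N + 1, N.succ_pos⟩ : ℕ+)).mono fun _ hn =>
    (Nat.le_succ N).trans (PNat.coe_le_coe _ _ |>.2 hn)

/-- A constant prefactor contributes `log C / n`, so neither the factors 2 and `1/2` nor the size of
a finite cover affects the rate. -/
lemma tendsto_log_mul_exp_div {C : ℝ} (hC : 0 < C) (a : ℝ) :
    Tendsto (fun n : ℕ+ => ENNReal.log (ENNReal.ofReal (C * Real.exp (-((n : ℕ) * a)))) /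
      ((n : ℕ) : EReal)) atTop (𝓝 ((-a : ℝ) : EReal)) := by
  have e : ∀ n : ℕ+, ENNReal.log (ENNReal.ofReal (C * Real.exp (-((n : ℕ) * a)))) /
      ((n : ℕ) : EReal) = ((Real.log C / (n : ℕ) - a : ℝ) : EReal) := fun n => by
    have hn : ((n : ℕ) : ℝ) ≠ 0 := by exact_mod_cast n.ne_zero
    rw [ENNReal.log_ofReal_of_pos (by positivity), Real.log_mul hC.ne' (Real.exp_pos _).ne',
      Real.log_exp, ← EReal.coe_natCast, ← EReal.coe_div]
    congr 1
    field_simp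
    ring
  simp_rw [e]
  rw [EReal.tendsto_coe]
  have h := ((tendsto_const_div_atTop_nhds_zero_nat (Real.log C)).comp
    PNat.tendsto_coe_atTop).sub_const a
  simpa using h

lemma limsup_log_div_le {p : ℕ+ → ℝ≥0∞} {C a : ℝ} (hC : 0 < C)
    (h : ∀ᶠ n : ℕ+ in atTop, p n ≤ ENNReal.ofReal (C * Real.exp (-((n : ℕ) * a)))) :
    limsup (fun n : ℕ+ => ENNReal.log (p n) / ((n : ℕ) : EReal)) atTop ≤ ((-a : ℝ) : EReal) := by
  rw [← (tendsto_log_mul_exp_div hC a).limsup_eq]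
  refine limsup_le_limsup ?_
  filter_upwards [h] with n hn
  exact EReal.div_le_div_right_of_nonneg (Nat.cast_nonneg' _) (ENNReal.log_monotone hn)

lemma le_liminf_log_div {p : ℕ+ → ℝ≥0∞} {C a : ℝ} (hC : 0 < C)
    (h : ∀ᶠ n : ℕ+ in atTop, ENNReal.ofReal (C * Real.exp (-((n : ℕ) * a))) ≤ p n) :
    ((-a : ℝ) : EReal) ≤ liminf (fun n : ℕ+ => ENNReal.log (p n) / ((n : ℕ) : EReal)) atTop := by
  rw [← (tendsto_log_mul_exp_div hC a).liminf_eq]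
  refine liminf_le_liminf ?_
  filter_upwards [h] with n hn
  exact EReal.div_le_div_right_of_nonneg (Nat.cast_nonneg' _) (ENNReal.log_monotone hn)

lemma copulaProb_mono (n : ℕ+) {A B : Set Copula} (h : A ⊆ B) : copulaProb n A ≤ copulaProb n B :=
  measure_mono fun _ hπ => h hπ

lemma limsup_log_copulaProb_le (A : Set Copula) {a ε : ℝ} (hε : 0 < ε)
    (ha : ENNReal.ofReal a < ⨅ μ ∈ closure A, copulaRate μ) :
    limsup (fun n : ℕ+ => ENNReal.log (copulaProb n A) / ((n : ℕ) : EReal)) atTop ≤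
      ((-(a - ε) : ℝ) : EReal) := by
  have h1 : ∀ μ : Copula, ∃ f : BoundedContinuousFunction (I × I) ℝ, μ ∈ closure A →
      a + (∫ p, Real.exp (f p)) - 1 < ∫ p, f p ∂(μ.1 : Measure (I × I)) := fun μ => by
    by_cases hμ : μ ∈ closure A
    · obtain ⟨f, hf⟩ := exists_boundedContinuous_lt_of_lt_copulaRate
        (ha.trans_le (iInf₂_le μ hμ))
      exact ⟨f, fun _ => hf⟩
    · exact ⟨0, fun h => absurd h hμ⟩
  choose f hf using h1
  let U : Copula → Set Copula := fun μ =>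
    {ν | a + (∫ p, Real.exp (f μ p)) - 1 < ∫ p, f μ p ∂(ν.1 : Measure (I × I))}
  have hU : ∀ μ ∈ closure A, U μ ∈ 𝓝 μ := fun μ hμ =>
    (continuous_integral_copula (f μ)).continuousAt.eventually (lt_mem_nhds (hf μ hμ))
  obtain ⟨s, -, hs⟩ := isClosed_closure.isCompact.elim_nhds_subcover U hU
  -- The `+ 1` keeps the constant positive when the cover `s` is empty.
  refine limsup_log_div_le (C := 2 * s.card + 1) (by positivity) ?_
  have h2 : ∀ᶠ n : ℕ+ in atTop, ∀ μ ∈ s, copulaProb n (U μ) ≤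
      ENNReal.ofReal (2 * Real.exp (-((n : ℕ) * (a - ε)))) := by
    rw [Filter.eventually_all_finset]
    intro μ _
    filter_upwards [PNat.tendsto_coe_atTop.eventually
      (eventually_permProb_le (f μ) hε (a + (∫ p, Real.exp (f μ p)) - 1))] with n hn
    refine hn.trans_eq ?_
    rw [ENNReal.ofReal_mul (by norm_num), ENNReal.ofReal_ofNat]
    congr 4
    ring
  filter_upwards [h2] with n hn
  calc copulaProb n A ≤ copulaProb n (⋃ μ ∈ s, U μ) :=
        copulaProb_mono n (subset_closure.trans hs)
    _ ≤ ∑ μ ∈ s, copulaProb n (U μ) := by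
        refine le_trans (measure_mono ?_) (measure_biUnion_finset_le s _)
        intro π hπ
        simpa using hπ
    _ ≤ ∑ _μ ∈ s, ENNReal.ofReal (2 * Real.exp (-((n : ℕ) * (a - ε)))) := Finset.sum_le_sum hn
    _ = ENNReal.ofReal (s.card * (2 * Real.exp (-((n : ℕ) * (a - ε))))) := by
        rw [Finset.sum_const, nsmul_eq_mul, ENNReal.ofReal_mul (Nat.cast_nonneg _),
          ENNReal.ofReal_natCast]
    _ ≤ _ := by
        refine ENNReal.ofReal_le_ofReal ?_
        have := Real.exp_pos (-((n : ℕ) * (a - ε)))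
        nlinarith

lemma le_liminf_log_copulaProb {A : Set Copula} {μ : Copula} (hμA : μ ∈ interior A)
    (hμ : copulaRate μ ≠ ∞) {η : ℝ} (hη : 0 < η) :
    ((-((copulaRate μ).toReal + η) : ℝ) : EReal) ≤
      liminf (fun n : ℕ+ => ENNReal.log (copulaProb n A) / ((n : ℕ) : EReal)) atTop := by
  obtain ⟨J, ε, hε, hJ⟩ := exists_finset_abs_integral_sub_lt_subset
    (mem_interior_iff_mem_nhds.1 hμA)
  refine le_liminf_log_div (C := 2⁻¹) (by norm_num) ?_
  filter_upwards [PNat.tendsto_coe_atTop.eventually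
    (eventually_le_permProb μ hμ J ε hε hη)] with n hn
  rw [ENNReal.ofReal_mul (by norm_num), ENNReal.ofReal_inv_of_pos (by norm_num),
    ENNReal.ofReal_ofNat]
  refine hn.trans (measure_mono ?_)
  intro π hπ
  exact hJ (permCopula n π) hπ

theorem mainTheorem2 :
    IsGoodRateFunction copulaRate ∧
    ∀ A : Set Copula,
      -((⨅ μ ∈ interior A, copulaRate μ : ℝ≥0∞) : EReal)
          ≤ liminf (fun n : ℕ+ => ENNReal.log (copulaProb n A) / ((n : ℕ) : EReal)) atTop ∧
      liminf (fun n : ℕ+ => ENNReal.log (copulaProb n A) / ((n : ℕ) : EReal)) atTop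
          ≤ limsup (fun n : ℕ+ => ENNReal.log (copulaProb n A) / ((n : ℕ) : EReal)) atTop ∧
      limsup (fun n : ℕ+ => ENNReal.log (copulaProb n A) / ((n : ℕ) : EReal)) atTop
          ≤ -((⨅ μ ∈ closure A, copulaRate μ : ℝ≥0∞) : EReal) := by
  have hcoe : ∀ {r : ℝ}, 0 ≤ r → ((ENNReal.ofReal r : ℝ≥0∞) : EReal) = (r : EReal) :=
    fun {r} hr => by rw [EReal.coe_ennreal_ofReal, max_eq_left hr]
  refine ⟨isGoodRateFunction_copulaRate, fun A => ⟨?_, liminf_le_limsup, ?_⟩⟩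
  · by_contra hlt
    obtain ⟨r, hr1, hr2⟩ := EReal.lt_iff_exists_real_btwn.1 (not_le.1 hlt)
    have h1 : ((⨅ μ ∈ interior A, copulaRate μ : ℝ≥0∞) : EReal) < ((-r : ℝ) : EReal) := by
      rw [EReal.coe_neg]
      exact EReal.lt_neg_comm.1 hr2
    have hr0 : 0 < -r := EReal.coe_pos.1 ((EReal.coe_ennreal_nonneg _).trans_lt h1)
    rw [← hcoe hr0.le, EReal.coe_ennreal_lt_coe_ennreal_iff] at h1
    simp only [iInf_lt_iff] at h1
    obtain ⟨μ, hμA, hμ⟩ := h1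
    have hD : (copulaRate μ).toReal < -r := (ENNReal.lt_ofReal_iff_toReal_lt hμ.ne_top).1 hμ
    -- This `η` makes the lower bound exactly `r`, contradicting `liminf < r`.
    have h2 := le_liminf_log_copulaProb hμA hμ.ne_top (η := -r - (copulaRate μ).toReal)
      (by linarith)
    rw [show -((copulaRate μ).toReal + (-r - (copulaRate μ).toReal)) = r by ring] at h2
    exact absurd hr1 (not_lt.2 h2)
  · by_contra hlt
    obtain ⟨r, hr1, hr2⟩ := EReal.lt_iff_exists_real_btwn.1 (not_le.1 hlt)
    have h1 : ((-r : ℝ) : EReal) < ((⨅ μ ∈ closure A, copulaRate μ : ℝ≥0∞) : EReal) := by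
      rw [EReal.coe_neg]
      exact EReal.neg_lt_comm.1 hr1
    -- Probabilities are at most 1, so the limsup is at most 0 and `r < 0`; hence `ENNReal.ofReal
    -- (-r)` loses nothing.
    have hle0 : limsup (fun n : ℕ+ => ENNReal.log (copulaProb n A) / ((n : ℕ) : EReal)) atTop ≤
        ((-0 : ℝ) : EReal) := by
      refine limsup_log_div_le one_pos (Eventually.of_forall fun n => ?_)
      have h : copulaProb n A ≤ 1 := (copulaProb_mono n (Set.subset_univ A)).trans_eq
        ((PMF.toOuterMeasure_apply_eq_one_iff _ _).2 (by simp))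
      simpa using h
    have hr0 : 0 < -r := by
      have := EReal.coe_lt_coe_iff.1 (hr2.trans_le hle0)
      linarith
    rw [← hcoe hr0.le, EReal.coe_ennreal_lt_coe_ennreal_iff] at h1
    -- A second real `r2` below the limsup leaves room for `ε = r2 - r`, and the upper bound becomes
    -- `r2`.
    obtain ⟨r2, hr3, hr4⟩ := EReal.lt_iff_exists_real_btwn.1 hr2
    have h2 := limsup_log_copulaProb_le A (sub_pos.2 (EReal.coe_lt_coe_iff.1 hr3)) h1
    rw [show -(-r - (r2 - r)) = r2 by ring] at h2
    exact absurd hr4 (not_lt.2 h2)
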